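/- Let $\boldsymbol\sigma=(\sigma_1,\sigma_2,\sigma_3)$ be the Pauli matrices, $\boldsymbol e_3=(0,0,1)^T$, and let $\boldsymbol m:\mathbb R\to\mathbb R^3$ satisfy $\|\boldsymbol m(z)\|=1$ for all $z$. Assume that (1) $\boldsymbol m-\boldsymbol e_3$ has its entries in $L^1(\mathbb R)$; (2) $\boldsymbol m$ is locally absolutely continuous and its (almost everywhere existing) derivative $\boldsymbol m'$ has its entries in $L^1(\mathbb R)$; (3) $m_3(z)>-1$ for each $z\in\mathbb R$. For $\lambda\in\overline{\mathbb C^+}$ let $\psi(\cdot,\lambda)$ and $\phi(\cdot,\lambda)$, and for $\lambda\in\overline{\mathbb C^-}$ let $\overline\psi(\cdot,\lambda)$ and $\overline\phi(\cdot,\lambda)$, be the (unique) $\mathbb C^2$-valued solutions of $f'(z)=i\lambda(\boldsymbol m(z)\cdot\boldsymbol\sigma)f(z)$, $z\in\mathbb R$, with $$e^{-i\lambda z}\psi\to\begin{pmatrix}1\\0\end{pmatrix},\quad e^{i\lambda z}\overline\psi\to\begin{pmatrix}0\\1\end{pmatrix}\quad(z\to+\infty),\qquad e^{-i\lambda z}\overline\phi\to\begin{pmatrix}1\\0\end{pmatrix},\quad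 e^{i\lambda z}\phi\to\begin{pmatrix}0\\1\end{pmatrix}\quad(z\to-\infty),$$ with components labelled "up" and "dn". For $\lambda\in\overline{\mathbb C^+}$ put $$a(\lambda)=1-i\lambda\int_{-\infty}^\infty\left[(m_3-1)e^{-i\lambda z}\psi^{up}(z,\lambda)+(m_1-im_2)e^{-i\lambda z}\psi^{dn}(z,\lambda)\right]dz,$$ and for $\lambda\in\mathbb R$ let $-b(\lambda)$ be the upper right entry of the matrix $T(\lambda)$, independent of $z$, with $(\psi\ \overline\psi)=(\overline\phi\ \phi)\,T(\lambda)$; then $T=\begin{pmatrix}a&-b\\b^*&a^*\end{pmatrix}$. Then these Jost functions exist and are unique, and for each $z\in\mathbb R$ the Faddeev functions $e^{-i\lambda z}\psi^{up}$, $e^{-i\lambda z}\psi^{dn}$, $e^{i\lambda z}\phi^{up}$, $e^{i\lambda z}\phi^{dn}$ are analytic in $\lambda\in\mathbb C^+$, continuous on $\overline{\mathbb C^+}$, and have a finite limit as $\lambda\to\infty$ from within $\overline{\mathbb C^+}$; the Faddeev functions $e^{i\lambda z}\overline\psi^{up}$, $e^{i\lambda z}\overline\psi^{dn}$, $e^{-i\lambda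 z}\overline\phi^{up}$, $e^{-i\lambda z}\overline\phi^{dn}$ are analytic in $\mathbb C^-$, continuous on $\overline{\mathbb C^-}$, and have a finite limit as $\lambda\to\infty$ from within $\overline{\mathbb C^-}$. The coefficient $a$ is analytic in $\mathbb C^+$, continuous on $\overline{\mathbb C^+}$, and has a finite limit as $\lambda\to\infty$ from within $\overline{\mathbb C^+}$, while $b(\lambda)\to0$ as $\lambda\to\pm\infty$. Moreover, $b$ may fail to admit an analytic continuation off the real line: there is an $\boldsymbol m$ as above for which no analytic function on an open neighbourhood of $\mathbb R$ in $\mathbb C$ coincides with $b$ on $\mathbb R$. -/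

import Mathlib

open Filter Topology MeasureTheory

noncomputable section

namespace Heisenberg

/-- The Pauli matrices. -/
def σ₁ : Matrix (Fin 2) (Fin 2) ℂ := !![0, 1; 1, 0]

def σ₂ : Matrix (Fin 2) (Fin 2) ℂ := !![0, -Complex.I; Complex.I, 0]

def σ₃ : Matrix (Fin 2) (Fin 2) ℂ := !![1, 0; 0, -1]

/-- The matrix `v · σ`. -/
def pauliDot (v : EuclideanSpace ℝ (Fin 3)) : Matrix (Fin 2) (Fin 2) ℂ :=
  (v 0 : ℂ) • σ₁ + (v 1 : ℂ) • σ₂ + (v 2 : ℂ) • σ₃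

/-- The vector `e₃ = (0, 0, 1)`. -/
def e₃ : EuclideanSpace ℝ (Fin 3) := EuclideanSpace.single 2 1

/-- The hypotheses on the potential: `m` is a field of unit vectors, `m - e₃` has integrable entries,
`m` is (locally) absolutely continuous with an almost everywhere defined derivative whose entries
are integrable, and `m₃ > -1` everywhere. -/
structure Admissible (m : ℝ → EuclideanSpace ℝ (Fin 3)) : Prop where
  norm_eq_one : ∀ z, ‖m z‖ = 1
  integrable_sub : ∀ i, Integrable (fun z => m z i - e₃ i)
  absolutelyContinuous : ∀ i, ∀ x y : ℝ, AbsolutelyContinuousOnInterval (fun z => m z i) x y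
  ae_differentiable : ∀ᵐ z, DifferentiableAt ℝ m z
  integrable_deriv : ∀ i, Integrable (deriv fun z => m z i)
  neg_one_lt : ∀ z, -1 < m z 2

/-- `f` solves `f' = i l (m · σ) f` on the line and `exp (-(s i l z)) f(z) → v` as `z → ±∞`
(the end is given by the filter `F`). -/
def IsJost (m : ℝ → EuclideanSpace ℝ (Fin 3)) (s : ℂ) (F : Filter ℝ) (v : Fin 2 → ℂ) (l : ℂ)
    (f : ℝ → Fin 2 → ℂ) : Prop :=
  (∀ z, HasDerivAt f (((Complex.I * l) • pauliDot (m z)).mulVec (f z)) z) ∧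
    Tendsto (fun z : ℝ => Complex.exp (-(s * Complex.I * l * z)) • f z) F (𝓝 v)

/-- `ψ(z, l) ~ exp (i l z) (1, 0)` as `z → +∞`, for `Im l ≥ 0`. -/
def IsPsi (m : ℝ → EuclideanSpace ℝ (Fin 3)) := IsJost m 1 atTop ![1, 0]

/-- `ψ̄(z, l) ~ exp (-i l z) (0, 1)` as `z → +∞`, for `Im l ≤ 0`. -/
def IsPsiBar (m : ℝ → EuclideanSpace ℝ (Fin 3)) := IsJost m (-1) atTop ![0, 1]

/-- `φ̄(z, l) ~ exp (i l z) (1, 0)` as `z → -∞`, for `Im l ≤ 0`. -/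
def IsPhiBar (m : ℝ → EuclideanSpace ℝ (Fin 3)) := IsJost m 1 atBot ![1, 0]

/-- `φ(z, l) ~ exp (-i l z) (0, 1)` as `z → -∞`, for `Im l ≥ 0`. -/
def IsPhi (m : ℝ → EuclideanSpace ℝ (Fin 3)) := IsJost m (-1) atBot ![0, 1]

/-- The Jost functions (arbitrary where the defining problem has no solution; the theorem
asserts that the problem is uniquely solvable in the closed half-plane concerned). -/
def psi (m : ℝ → EuclideanSpace ℝ (Fin 3)) (z : ℝ) (l : ℂ) : Fin 2 → ℂ :=
  Classical.epsilon (IsPsi m l) z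

def psiBar (m : ℝ → EuclideanSpace ℝ (Fin 3)) (z : ℝ) (l : ℂ) : Fin 2 → ℂ :=
  Classical.epsilon (IsPsiBar m l) z

def phiBar (m : ℝ → EuclideanSpace ℝ (Fin 3)) (z : ℝ) (l : ℂ) : Fin 2 → ℂ :=
  Classical.epsilon (IsPhiBar m l) z

def phi (m : ℝ → EuclideanSpace ℝ (Fin 3)) (z : ℝ) (l : ℂ) : Fin 2 → ℂ :=
  Classical.epsilon (IsPhi m l) z

/-- The Jost matrix `Ψ = (ψ ψ̄)`. -/
def Psi (m : ℝ → EuclideanSpace ℝ (Fin 3)) (z : ℝ) (l : ℂ) : Matrix (Fin 2) (Fin 2) ℂ :=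
  !![psi m z l 0, psiBar m z l 0; psi m z l 1, psiBar m z l 1]

/-- The Jost matrix `Φ = (φ̄ φ)`. -/
def Phi (m : ℝ → EuclideanSpace ℝ (Fin 3)) (z : ℝ) (l : ℂ) : Matrix (Fin 2) (Fin 2) ℂ :=
  !![phiBar m z l 0, phi m z l 0; phiBar m z l 1, phi m z l 1]

/-- The coefficient `a(l)` on the closed upper half-plane,
`1 - i l ∫ (m₃ - 1) e^{-ilz} ψ^up + m₋ e^{-ilz} ψ^dn dz` with `m₋ = m₁ - i m₂`. -/
def a (m : ℝ → EuclideanSpace ℝ (Fin 3)) (l : ℂ) : ℂ :=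
  1 - Complex.I * l * ∫ z : ℝ,
    (((m z 2 : ℂ) - 1) * (Complex.exp (-(Complex.I * l * z)) * psi m z l 0) +
      ((m z 0 : ℂ) - Complex.I * (m z 1 : ℂ)) *
        (Complex.exp (-(Complex.I * l * z)) * psi m z l 1))

/-- The transition matrix `T` with `Ψ(z, x) = Φ(z, x) T(x)` for real `x`. -/
def transition (m : ℝ → EuclideanSpace ℝ (Fin 3)) (x : ℝ) : Matrix (Fin 2) (Fin 2) ℂ :=
  (Phi m 0 x)⁻¹ * Psi m 0 x

/-- The coefficient `b`, minus the upper right entry of the transition matrix. -/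
def b (m : ℝ → EuclideanSpace ℝ (Fin 3)) (x : ℝ) : ℂ := -transition m x 0 1

/-- The open upper and lower half-planes. -/
def upperPlane : Set ℂ := {l | 0 < l.im}

def lowerPlane : Set ℂ := {l | l.im < 0}

/-- `f` is analytic in `U`, continuous on the closure of `U`, and has a finite limit as `l → ∞`
from within the closure of `U`. -/
def RegularWithLimit (U : Set ℂ) (f : ℂ → ℂ) : Prop :=
  AnalyticOnNhd ℂ f U ∧ ContinuousOn f (closure U) ∧
    ∃ L : ℂ, Tendsto f (Bornology.cobounded ℂ ⊓ 𝓟 (closure U)) (𝓝 L)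

end Heisenberg

end

namespace Heisenberg
open Set

/-! ### Absolutely continuous functions -/

/-! The obstacle is that the spectral parameter multiplies the potential: a Volterra equation built
on `m - e₃` has a kernel of size |λ|, so it gives no control as λ → ∞. A gauge transformation moves
λ onto a constant diagonal matrix. With p = (1 + m₃)/2 and q± = (m₁ ± i m₂)/2, the matrix V with
rows (p, -q₋) and (q₊, p) satisfies (m·σ)V = Vσ₃ and has determinant p, both because |m| = 1.
Writing ψ = e^{iλz} V h turns the system into h' = iλ(σ₃ - 1)h + Wh with W = -V⁻¹V'. This W does not
involve λ, and it is integrable: m' is, and p is bounded away from 0 because m₃ > -1 is continuous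
and tends to 1 at both ends.

The resulting Volterra equation has kernels 1 and e^{2iλ(y-z)} with y ≥ z, bounded by 1 on the
closed upper half-plane. Its Neumann series is therefore dominated by Mⁿ/n! uniformly in λ, and
analyticity, continuity and the limit at ∞ pass from the terms to the sum
(`exists_volterra_solution`). By a Riemann-Lebesgue lemma in the closed half-plane the second
component of h tends to 0, so the limit of e^{-iλz}ψ is a multiple of the first column of V(z), that
is, of (1 + m₃, m₁ + i m₂) (`exists_faddeev`). The other Jost functions follow from ψ by the
reflection z ↦ -z, λ ↦ -λ and by the antiunitary symmetry `conjFlip`. Uniqueness rests on the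
constancy of Wronskians.

The coefficient a is the Wronskian of ψ and φ (`a_eq_wronskian`), hence a combination of Faddeev
functions at z = 0. The conjugate of b is the Wronskian of φ̄ and ψ on the real line. Both of these
become parallel to the same vector, which depends on m(0) only, so b → 0 (`tendsto_b`).

For the counterexample, `exists_norm_star_b_add_le` shows that the conjugate of b(x) is -ix ∫
e^{2ixz}(m₁ + i m₂) dz + O(x²). If b were analytic at 0, this Fourier integral would be Lipschitz at
0. It is not when m₁ is nonnegative with tails of order |z|^{-3/2} and m₂ = 0. -/

theorem absolutelyContinuousOnInterval_ofReal {f : ℝ → ℝ} {a b : ℝ}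
    (hf : AbsolutelyContinuousOnInterval f a b) :
    AbsolutelyContinuousOnInterval (fun x => (f x : ℂ)) a b := by
  have : LipschitzOnWith 1 (fun x : ℝ => (x : ℂ)) univ :=
    (Complex.isometry_ofReal.lipschitz).lipschitzOnWith
  rw [absolutelyContinuousOnInterval_iff] at hf ⊢
  simpa [Complex.isometry_ofReal.dist_eq] using hf

theorem absolutelyContinuousOnInterval_intervalIntegral {f : ℝ → ℂ}
    (hf : ∀ a b, IntervalIntegrable f volume a b) (c a b : ℝ) :
    AbsolutelyContinuousOnInterval (fun x => ∫ v in c..x, f v) a b := by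
  have key : ∀ g : ℝ → ℝ, (∀ a b, IntervalIntegrable g volume a b) →
      AbsolutelyContinuousOnInterval (fun x => ∫ v in c..x, g v) a b := fun g hg =>
    (IntervalIntegrable.absolutelyContinuousOnInterval_intervalIntegral
      (a := min c (min a b)) (b := max c (max a b)) (c := c) (hg _ _)
      (by rw [uIcc_of_le] <;> simp)).mono (by
        rw [uIcc_of_le (a := min c (min a b)) (by simp)]
        exact uIcc_subset_Icc (by simp) (by simp))
  have hre := absolutelyContinuousOnInterval_ofReal (key (fun x => (f x).re) fun a b =>
    ⟨(hf a b).1.re, (hf a b).2.re⟩)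
  have him := absolutelyContinuousOnInterval_ofReal (key (fun x => (f x).im) fun a b =>
    ⟨(hf a b).1.im, (hf a b).2.im⟩)
  refine (congrArg (AbsolutelyContinuousOnInterval · a b) (funext fun x => ?_)).mpr
    (hre.fun_add (him.const_smul Complex.I))
  rw [smul_eq_mul, ← intervalIntegral.integral_ofReal, ← intervalIntegral.integral_ofReal,
    ← intervalIntegral.integral_const_mul, ← intervalIntegral.integral_add]
  · refine intervalIntegral.integral_congr fun y _ => ?_
    rw [mul_comm, Complex.re_add_im]
  · exact ⟨(hf c x).1.re.ofReal, (hf c x).2.re.ofReal⟩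
  · exact IntervalIntegrable.const_mul ⟨(hf c x).1.im.ofReal, (hf c x).2.im.ofReal⟩ _

/-- The function differs from the primitive of `g` by an absolutely continuous function with
derivative zero almost everywhere, which is constant. This upgrades an almost everywhere product
rule to a differential equation valid at every point. -/
theorem hasDerivAt_of_absolutelyContinuousOnInterval {f g : ℝ → ℂ}
    (hf : ∀ a b, AbsolutelyContinuousOnInterval f a b) (hg : Continuous g)
    (h : ∀ᵐ x, HasDerivAt f (g x) x) (x : ℝ) : HasDerivAt f (g x) x := by
  have hG : ∀ y, HasDerivAt (fun x => ∫ v in (0 : ℝ)..x, g v) (g y) y := fun y =>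
    intervalIntegral.integral_hasDerivAt_right (hg.intervalIntegrable _ _)
      (hg.stronglyMeasurableAtFilter _ _) hg.continuousAt
  have hfe : ∀ y, f y = f 0 + ∫ v in (0 : ℝ)..y, g v := by
    intro y
    obtain ⟨C, hC⟩ := ((hf 0 y).fun_sub (absolutelyContinuousOnInterval_intervalIntegral
      (fun a b => hg.intervalIntegrable a b) 0 0 y)).const_of_ae_hasDerivAt_zero (by
        filter_upwards [h] with z hz _
        simpa using hz.fun_sub (hG z))
    have h0 := hC 0 left_mem_uIcc
    have hy := hC y right_mem_uIcc
    simp only [intervalIntegral.integral_same, sub_zero] at h0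
    linear_combination hy - h0
  rw [show f = fun y => f 0 + ∫ v in (0 : ℝ)..y, g v from funext hfe]
  exact (hG x).const_add _

theorem absolutelyContinuousOnInterval_of_hasDerivAt {f g : ℝ → ℂ} (hg : Continuous g)
    (h : ∀ x, HasDerivAt f (g x) x) (a b : ℝ) : AbsolutelyContinuousOnInterval f a b := by
  refine ContDiffOn.absolutelyContinuousOnInterval (ContDiff.contDiffOn ?_)
  rw [contDiff_one_iff_deriv]
  refine ⟨fun x => (h x).differentiableAt, ?_⟩
  rwa [show deriv f = g from funext fun x => (h x).deriv]

/-! ### Tail integrals -/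

section Tail

variable {E : Type*} [NormedAddCommGroup E] [NormedSpace ℝ E] {f : ℝ → E}

omit [NormedSpace ℝ E] in
theorem intervalIntegrable_of_integrableOn_Ioi (hf : ∀ a, IntegrableOn f (Ioi a)) (a b : ℝ) :
    IntervalIntegrable f volume a b := by
  rw [intervalIntegrable_iff, uIoc]
  exact (hf _).mono_set Ioc_subset_Ioi_self

theorem integral_Ioi_eq_sub (hf : ∀ a, IntegrableOn f (Ioi a)) (z : ℝ) :
    ∫ y in Ioi z, f y = (∫ y in Ioi 0, f y) - ∫ y in (0 : ℝ)..z, f y := by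
  rw [← intervalIntegral.integral_interval_add_Ioi' (b := z)
    (intervalIntegrable_of_integrableOn_Ioi hf 0 z) (hf z)]
  abel

theorem continuous_integral_Ioi (hf : ∀ a, IntegrableOn f (Ioi a)) :
    Continuous fun z => ∫ y in Ioi z, f y := by
  rw [show (fun z => ∫ y in Ioi z, f y) = _ from funext (integral_Ioi_eq_sub hf)]
  exact continuous_const.sub (intervalIntegral.continuous_primitive
    (intervalIntegrable_of_integrableOn_Ioi hf) 0)

theorem ae_hasDerivAt_integral_Ioi [CompleteSpace E] (hf : ∀ a, IntegrableOn f (Ioi a)) :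
    ∀ᵐ z, HasDerivAt (fun z => ∫ y in Ioi z, f y) (-f z) z := by
  have hl : LocallyIntegrable f := fun x =>
    ⟨Ioi (x - 1), Ioi_mem_nhds (by linarith), hf _⟩
  filter_upwards [LocallyIntegrable.ae_hasDerivAt_integral hl] with z hz
  rw [show (fun z => ∫ y in Ioi z, f y) = _ from funext (integral_Ioi_eq_sub hf)]
  exact (hz 0).const_sub _

theorem tendsto_integral_Ioi_atTop : Tendsto (fun z => ∫ y in Ioi z, f y) atTop (𝓝 0) :=
  tendsto_integral_Ioi_zero tendsto_id

end Tail

theorem absolutelyContinuousOnInterval_integral_Ioi {f : ℝ → ℂ}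
    (hf : ∀ a, IntegrableOn f (Ioi a)) (a b : ℝ) :
    AbsolutelyContinuousOnInterval (fun z => ∫ y in Ioi z, f y) a b := by
  rw [show (fun z => ∫ y in Ioi z, f y) = _ from funext (integral_Ioi_eq_sub hf)]
  refine AbsolutelyContinuousOnInterval.fun_sub ?_
    (absolutelyContinuousOnInterval_intervalIntegral
      (intervalIntegrable_of_integrableOn_Ioi hf) 0 a b)
  exact ((LipschitzWith.const _).lipschitzOnWith (s := uIcc a b)).absolutelyContinuousOnInterval

/-- The weights `N(z)^n / n!`, `N(z) = ∫_z^∞ k`, dominating iterated Volterra integrals. -/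
theorem integral_Ioi_mul_pow {k : ℝ → ℝ} (hk : Integrable k) (n : ℕ) (z : ℝ) :
    ∫ y in Ioi z, k y * ((∫ x in Ioi y, k x) ^ n / n.factorial) =
      (∫ x in Ioi z, k x) ^ (n + 1) / (n + 1).factorial := by
  set N : ℝ → ℝ := fun z => ∫ x in Ioi z, k x with hN
  have hkI : ∀ a, IntegrableOn k (Ioi a) := fun a => hk.integrableOn
  have hNc : Continuous N := continuous_integral_Ioi hkI
  have hNb : ∀ y, ‖N y‖ ≤ ∫ x, ‖k x‖ := fun y =>
    (norm_integral_le_integral_norm _).trans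
      (setIntegral_le_integral hk.norm (Eventually.of_forall fun _ => norm_nonneg _))
  have hFi : Integrable fun y => k y * (N y ^ n / n.factorial) := by
    refine hk.mul_bdd (c := (∫ x, ‖k x‖) ^ n / n.factorial)
      ((hNc.pow n).div_const _).aestronglyMeasurable (Eventually.of_forall fun y => ?_)
    rw [norm_div, norm_pow, Real.norm_natCast]
    gcongr
    exact hNb y
  have hFI : ∀ a, IntegrableOn (fun y => k y * (N y ^ n / n.factorial)) (Ioi a) :=
    fun a => hFi.integrableOn
  have hac : ∀ {f : ℝ → ℝ}, (∀ a, IntegrableOn f (Ioi a)) → ∀ a b,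
      AbsolutelyContinuousOnInterval (fun z => ∫ y in Ioi z, f y) a b := by
    intro f hf a b
    have := absolutelyContinuousOnInterval_integral_Ioi (f := fun x => (f x : ℂ))
      (fun a => (hf a).ofReal) a b
    rw [absolutelyContinuousOnInterval_iff] at this ⊢
    simpa [integral_complex_ofReal, Complex.isometry_ofReal.dist_eq] using this
  have hpow : ∀ m a b, AbsolutelyContinuousOnInterval (fun z => N z ^ m) a b := by
    intro m a b
    induction m with
    | zero =>
      simp only [pow_zero]
      exact ((LipschitzWith.const _).lipschitzOnWith
        (s := uIcc a b)).absolutelyContinuousOnInterval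
    | succ m ih => simpa only [pow_succ] using ih.fun_mul (hac hkI a b)
  -- The difference of the two sides is absolutely continuous with derivative zero almost
  -- everywhere, hence constant, and it vanishes at +∞.
  set D : ℝ → ℝ := fun z => (∫ y in Ioi z, k y * (N y ^ n / n.factorial)) -
    ((n + 1).factorial : ℝ)⁻¹ * N z ^ (n + 1) with hD
  have hconst : ∀ z w, D z = D w := by
    intro z w
    obtain ⟨C, hC⟩ := ((hac hFI z w).fun_sub
      ((hpow (n + 1) z w).const_mul ((n + 1).factorial : ℝ)⁻¹)).const_of_ae_hasDerivAt_zero (by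
        filter_upwards [ae_hasDerivAt_integral_Ioi hFI, ae_hasDerivAt_integral_Ioi hkI]
          with x h1 h2 _
        have := h1.fun_sub ((h2.fun_pow (n + 1)).const_mul ((n + 1).factorial : ℝ)⁻¹)
        convert this using 1
        rw [Nat.factorial_succ]
        have : (n.factorial : ℝ) ≠ 0 := by positivity
        have : (n + 1 : ℝ) ≠ 0 := by positivity
        push_cast
        field_simp
        simp [hN])
    exact (hC z left_mem_uIcc).trans (hC w right_mem_uIcc).symm
  have hlim : Tendsto D atTop (𝓝 0) := by
    have h1 : Tendsto (fun z => ∫ y in Ioi z, k y * (N y ^ n / n.factorial)) atTop (𝓝 0) :=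
      tendsto_integral_Ioi_atTop
    have h2 : Tendsto N atTop (𝓝 0) := tendsto_integral_Ioi_atTop
    simpa using h1.sub ((h2.pow (n + 1)).const_mul ((n + 1).factorial : ℝ)⁻¹)
  have hz : D z = 0 := tendsto_nhds_unique
    (tendsto_const_nhds.congr fun w => hconst z w) hlim
  have := sub_eq_zero.1 hz
  rw [this, div_eq_inv_mul]

/-! ### Regular functions on the closed upper half-plane -/

theorem closure_upperPlane : closure upperPlane = {l : ℂ | 0 ≤ l.im} :=
  Complex.closure_setOfPred_lt_im 0

theorem closure_lowerPlane : closure lowerPlane = {l : ℂ | l.im ≤ 0} :=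
  Complex.closure_setOfPred_im_lt 0

theorem isOpen_upperPlane : IsOpen upperPlane := isOpen_lt continuous_const Complex.continuous_im

theorem isOpen_lowerPlane : IsOpen lowerPlane := isOpen_lt Complex.continuous_im continuous_const

theorem ofReal_mem_closure_upperPlane (x : ℝ) : (x : ℂ) ∈ closure upperPlane := by
  simp [closure_upperPlane]

theorem ofReal_mem_closure_lowerPlane (x : ℝ) : (x : ℂ) ∈ closure lowerPlane := by
  simp [closure_lowerPlane]

/-- Neighbourhoods of `∞` within the closed upper half-plane. -/
noncomputable def upperInfty : Filter ℂ := Bornology.cobounded ℂ ⊓ 𝓟 (closure upperPlane)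

instance : upperInfty.IsCountablyGenerated := by
  unfold upperInfty
  rw [← comap_norm_atTop]
  infer_instance

theorem eventually_mem_upperInfty : ∀ᶠ l in upperInfty, l ∈ closure upperPlane :=
  mem_inf_of_right (mem_principal_self _)

theorem tendsto_norm_upperInfty : Tendsto (fun l : ℂ => ‖l‖) upperInfty atTop :=
  tendsto_norm_cobounded_atTop.mono_left inf_le_left

theorem tendsto_ofReal_upperInfty {F : Filter ℝ} (hF : F ≤ Bornology.cobounded ℝ) :
    Tendsto (fun x : ℝ => (x : ℂ)) F upperInfty := by
  refine tendsto_inf.2 ⟨?_, tendsto_principal.2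
    (Eventually.of_forall ofReal_mem_closure_upperPlane)⟩
  rw [← tendsto_norm_atTop_iff_cobounded]
  simpa only [Complex.norm_real] using
    (tendsto_norm_cobounded_atTop (E := ℝ)).mono_left hF

instance : upperInfty.NeBot :=
  (tendsto_ofReal_upperInfty (F := atTop)
    (by rw [IsOrderBornology.cobounded_eq]; exact le_sup_right)).neBot

theorem regularWithLimit_upperPlane {f : ℂ → ℂ} {L : ℂ}
    (hc : ContinuousOn f (closure upperPlane))
    (hd : DifferentiableOn ℂ f upperPlane) (hL : Tendsto f upperInfty (𝓝 L)) :
    RegularWithLimit upperPlane f :=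
  ⟨hd.analyticOnNhd isOpen_upperPlane, hc, L, hL⟩

theorem RegularWithLimit.congr {U : Set ℂ} {f g : ℂ → ℂ} (hU : IsOpen U)
    (hf : RegularWithLimit U f) (h : EqOn f g (closure U)) : RegularWithLimit U g := by
  obtain ⟨ha, hc, L, hL⟩ := hf
  refine ⟨ha.congr hU (h.mono subset_closure), hc.congr h.symm, L, hL.congr' ?_⟩
  exact eventually_inf_principal.2 (Eventually.of_forall h)

theorem RegularWithLimit.add {U : Set ℂ} {f g : ℂ → ℂ} (hf : RegularWithLimit U f)
    (hg : RegularWithLimit U g) : RegularWithLimit U fun l => f l + g l := by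
  obtain ⟨ha, hc, L, hL⟩ := hf
  obtain ⟨ha', hc', L', hL'⟩ := hg
  exact ⟨ha.add ha', hc.add hc', _, hL.add hL'⟩

theorem RegularWithLimit.mul {U : Set ℂ} {f g : ℂ → ℂ} (hf : RegularWithLimit U f)
    (hg : RegularWithLimit U g) : RegularWithLimit U fun l => f l * g l := by
  obtain ⟨ha, hc, L, hL⟩ := hf
  obtain ⟨ha', hc', L', hL'⟩ := hg
  exact ⟨ha.mul ha', hc.mul hc', _, hL.mul hL'⟩

theorem RegularWithLimit.const {U : Set ℂ} (c : ℂ) : RegularWithLimit U fun _ => c :=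
  ⟨analyticOnNhd_const, continuousOn_const, c, tendsto_const_nhds⟩

/-! ### Integrals depending on a parameter -/

section Parameter

variable {μ : Measure ℝ} {G : ℂ → ℝ → ℂ} {k : ℝ → ℝ}

/-- Only the integrand itself is dominated. Cauchy's estimate on circles of radius `r` converts this
into the bound `k / r` for its derivative; with `r = l₀.im / 4` the closed `r`-balls centred in the
`r`-ball about `l₀` stay in the half-plane. -/
theorem differentiableOn_integral_of_dominated (hk : Integrable k μ)
    (hm : ∀ l ∈ upperPlane, AEStronglyMeasurable (G l) μ)
    (hb : ∀ᵐ y ∂μ, ∀ l ∈ upperPlane, ‖G l y‖ ≤ k y)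
    (hd : ∀ᵐ y ∂μ, DifferentiableOn ℂ (fun l => G l y) upperPlane) :
    DifferentiableOn ℂ (fun l => ∫ y, G l y ∂μ) upperPlane := by
  intro l₀ hl₀
  have hl₀' : 0 < l₀.im := hl₀
  set r := l₀.im / 4 with hr
  have hr0 : 0 < r := by positivity
  have hsub : ∀ x ∈ Metric.ball l₀ r, Metric.closedBall x r ⊆ upperPlane := by
    intro x hx w hw
    have h1 : |(x - l₀).im| < r := (Complex.abs_im_le_norm _).trans_lt
      (by simpa [dist_eq_norm] using hx)
    have h2 : |(w - x).im| ≤ r := (Complex.abs_im_le_norm _).trans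
      (by simpa [dist_eq_norm] using hw)
    rw [Complex.sub_im] at h1 h2
    have := abs_lt.1 h1
    have := abs_le.1 h2
    change 0 < w.im
    linarith
  have hmem : ∀ x ∈ Metric.ball l₀ r, x ∈ upperPlane := fun x hx =>
    hsub x hx (Metric.mem_closedBall_self hr0.le)
  have hder : ∀ᵐ y ∂μ, ∀ x ∈ Metric.ball l₀ r,
      HasDerivAt (fun l => G l y) (deriv (fun l => G l y) x) x := by
    filter_upwards [hd] with y hy x hx
    exact (hy.differentiableAt (isOpen_upperPlane.mem_nhds (hmem x hx))).hasDerivAt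
  have hbd : ∀ᵐ y ∂μ, ∀ x ∈ Metric.ball l₀ r, ‖deriv (fun l => G l y) x‖ ≤ k y / r := by
    filter_upwards [hd, hb] with y hy hby x hx
    refine Complex.norm_deriv_le_of_forall_mem_sphere_norm_le hr0 ?_ fun w hw =>
      hby w (hsub x hx (Metric.sphere_subset_closedBall hw))
    exact (hy.mono (hsub x hx)).diffContOnCl_ball subset_rfl
  -- Difference quotients along a sequence exhibit the derivative at `l₀` as an almost everywhere
  -- limit of measurable functions.
  have hseq : Tendsto (fun n : ℕ => l₀ + (r / 2 : ℝ) * (1 / ((n : ℂ) + 1))) atTop (𝓝[≠] l₀) := by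
    refine tendsto_nhdsWithin_iff.2 ⟨?_, Eventually.of_forall fun n => ?_⟩
    · have := (tendsto_one_div_add_atTop_nhds_zero_nat (𝕜 := ℂ)).const_mul ((r / 2 : ℝ) : ℂ)
      simpa using this.const_add l₀
    · have h1 : ((r / 2 : ℝ) : ℂ) ≠ 0 := by exact_mod_cast (by positivity : r / 2 ≠ 0)
      have h2 : (n : ℂ) + 1 ≠ 0 := Nat.cast_add_one_ne_zero n
      have : ((r / 2 : ℝ) : ℂ) * (1 / ((n : ℂ) + 1)) ≠ 0 :=
        mul_ne_zero h1 (one_div_ne_zero h2)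
      simpa using this
  have hseqU : ∀ n : ℕ, l₀ + (r / 2 : ℝ) * (1 / ((n : ℂ) + 1)) ∈ upperPlane := by
    intro n
    refine hmem _ ?_
    rw [Metric.mem_ball, dist_eq_norm, add_sub_cancel_left, norm_mul, norm_div, norm_one,
      Complex.norm_real, Real.norm_of_nonneg (by positivity)]
    have : (1 : ℝ) ≤ ‖(n : ℂ) + 1‖ := by
      rw [← Nat.cast_succ, Complex.norm_natCast]
      exact_mod_cast Nat.succ_pos n
    have : 1 / ‖(n : ℂ) + 1‖ ≤ 1 := by
      rw [div_le_one (by linarith)]; exact this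
    nlinarith
  have hmeas : AEStronglyMeasurable (fun y => deriv (fun l => G l y) l₀) μ := by
    refine aestronglyMeasurable_of_tendsto_ae (u := atTop)
      (f := fun (n : ℕ) y => slope (fun l => G l y) l₀ (l₀ + (r / 2 : ℝ) * (1 / ((n : ℂ) + 1))))
      (fun n => ?_) ?_
    · simp only [slope_def_field]
      simp only [div_eq_mul_inv]
      exact AEStronglyMeasurable.mul_const ((hm _ (hseqU n)).sub (hm _ hl₀)) _
    · filter_upwards [hder] with y hy
      exact (hasDerivAt_iff_tendsto_slope.1 (hy l₀ (Metric.mem_ball_self hr0))).comp hseq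
  refine (hasDerivAt_integral_of_dominated_loc_of_deriv_le (bound := fun y => k y / r)
    (F' := fun x y => deriv (fun l => G l y) x)
    (Metric.ball_mem_nhds l₀ hr0) ?_ ?_ hmeas hbd (hk.div_const r) hder).2
    |>.differentiableAt.differentiableWithinAt
  · filter_upwards [Metric.ball_mem_nhds l₀ hr0] with x hx
    exact hm x (hmem x hx)
  · refine hk.mono' (hm _ hl₀) ?_
    filter_upwards [hb] with y hy using hy _ hl₀

end Parameter

/-! ### The Riemann-Lebesgue lemma in the closed upper half-plane -/

theorem norm_exp_two_I_mul_le {l : ℂ} (hl : l ∈ closure upperPlane) {t : ℝ} (ht : 0 ≤ t) :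
    ‖Complex.exp (2 * Complex.I * l * t)‖ ≤ 1 := by
  rw [closure_upperPlane] at hl
  rw [Complex.norm_exp]
  refine Real.exp_le_one_iff.2 ?_
  have : (2 * Complex.I * l * t).re = -(2 * (l.im * t)) := by simp; ring
  rw [this]
  have : 0 ≤ l.im * t := mul_nonneg hl ht
  linarith

theorem continuous_exp_kernel (l : ℂ) (z : ℝ) :
    Continuous fun y : ℝ => Complex.exp (2 * Complex.I * l * ((y - z : ℝ) : ℂ)) := by
  fun_prop

theorem integrableOn_exp_mul {f : ℝ → ℂ} {l : ℂ} (hl : l ∈ closure upperPlane) {z : ℝ}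
    (hf : IntegrableOn f (Ioi z)) :
    IntegrableOn (fun y => Complex.exp (2 * Complex.I * l * ((y - z : ℝ) : ℂ)) * f y) (Ioi z) := by
  refine Integrable.bdd_mul (c := 1) hf (continuous_exp_kernel l z).aestronglyMeasurable ?_
  filter_upwards [self_mem_ae_restrict measurableSet_Ioi] with y hy
  exact norm_exp_two_I_mul_le hl (sub_nonneg.2 (le_of_lt hy))

theorem norm_integral_exp_mul_le {f : ℝ → ℂ} {l : ℂ} (hl : l ∈ closure upperPlane) {z : ℝ}
    (hf : IntegrableOn f (Ioi z)) :
    ‖∫ y in Ioi z, Complex.exp (2 * Complex.I * l * ((y - z : ℝ) : ℂ)) * f y‖ ≤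
      ∫ y in Ioi z, ‖f y‖ := by
  refine norm_integral_le_of_norm_le hf.norm ?_
  filter_upwards [self_mem_ae_restrict measurableSet_Ioi] with y hy
  rw [norm_mul]
  exact mul_le_of_le_one_left (norm_nonneg _)
    (norm_exp_two_I_mul_le hl (sub_nonneg.2 (le_of_lt hy)))

/-- One integration by parts gains the factor 1/(2iλ). The kernel is bounded by 1 for y ≥ z, so the
decay of order 1/|λ| is uniform over all directions in the closed half-plane. -/
theorem tendsto_integral_exp_mul_of_contDiff {g : ℝ → ℂ} (hg : ContDiff ℝ 1 g)
    (hs : HasCompactSupport g) (z : ℝ) :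
    Tendsto (fun l : ℂ => ∫ y in Ioi z,
      Complex.exp (2 * Complex.I * l * ((y - z : ℝ) : ℂ)) * g y) upperInfty (𝓝 0) := by
  have hgi : Integrable g := hg.continuous.integrable_of_hasCompactSupport hs
  have hg' : Continuous (deriv g) := hg.continuous_deriv le_rfl
  have hgi' : Integrable (deriv g) := hg'.integrable_of_hasCompactSupport hs.deriv
  have key : ∀ l ∈ closure upperPlane, l ≠ 0 →
      ‖∫ y in Ioi z, Complex.exp (2 * Complex.I * l * ((y - z : ℝ) : ℂ)) * g y‖ ≤
        ‖l‖⁻¹ * (‖g z‖ + ∫ y in Ioi z, ‖deriv g y‖) := by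
    intro l hl hl0
    set e : ℝ → ℂ := fun y => Complex.exp (2 * Complex.I * l * ((y - z : ℝ) : ℂ)) with he
    have hed : ∀ y, HasDerivAt e (2 * Complex.I * l * e y) y := by
      intro y
      have h1 : HasDerivAt (fun y : ℝ => 2 * Complex.I * l * ((y - z : ℝ) : ℂ))
          (2 * Complex.I * l) y := by
        have := ((hasDerivAt_id y).sub_const z).ofReal_comp.const_mul (2 * Complex.I * l)
        simpa using this
      rw [mul_comm]
      exact h1.cexp
    have h1 := integrableOn_exp_mul hl (hgi.integrableOn (s := Ioi z))
    have h2 := integrableOn_exp_mul hl (hgi'.integrableOn (s := Ioi z))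
    have hparts : ∫ y in Ioi z, (2 * Complex.I * l * e y * g y + e y * deriv g y) =
        0 - e z * g z := by
      refine integral_Ioi_of_hasDerivAt_of_tendsto' (f := fun y => e y * g y) (fun y _ => ?_) ?_ ?_
      · exact (hed y).mul (hg.differentiable one_ne_zero y).hasDerivAt
      · refine (h1.const_mul (2 * Complex.I * l)).add h2 |>.congr ?_
        exact Eventually.of_forall fun y => by simp only [Pi.add_apply, he]; ring
      · have h0 : Tendsto (fun y => ‖g y‖) atTop (𝓝 0) := by
          simpa using (hs.is_zero_at_infty.mono_left atTop_le_cocompact).norm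
        refine squeeze_zero_norm' ?_ h0
        filter_upwards [eventually_ge_atTop z] with y hy
        rw [norm_mul]
        exact mul_le_of_le_one_left (norm_nonneg _)
          (norm_exp_two_I_mul_le hl (sub_nonneg.2 hy))
    have hez : e z = 1 := by simp [he]
    have hI : ∫ y in Ioi z, e y * g y =
        (2 * Complex.I * l)⁻¹ * (-g z - ∫ y in Ioi z, e y * deriv g y) := by
      have : ∫ y in Ioi z, (2 * Complex.I * l * e y * g y + e y * deriv g y) =
          2 * Complex.I * l * (∫ y in Ioi z, e y * g y) + ∫ y in Ioi z, e y * deriv g y := by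
        rw [← integral_const_mul, ← integral_add (h1.const_mul _) h2]
        simp only [he, mul_assoc]
      rw [this, hez] at hparts
      have h2I : 2 * Complex.I * l ≠ 0 := by simp [hl0]
      field_simp
      linear_combination hparts
    rw [hI, norm_mul, norm_inv]
    gcongr
    · simp only [norm_mul, Complex.norm_ofNat, Complex.norm_I]
      nlinarith [norm_nonneg l]
    · refine (norm_sub_le _ _).trans ?_
      rw [norm_neg]
      exact add_le_add_right (norm_integral_exp_mul_le hl hgi'.integrableOn) _
  refine squeeze_zero_norm' (a := fun l => ‖l‖⁻¹ * (‖g z‖ + ∫ y in Ioi z, ‖deriv g y‖)) ?_ ?_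
  · filter_upwards [eventually_mem_upperInfty, tendsto_norm_upperInfty.eventually_gt_atTop 0]
      with l hl hl0
    exact key l hl (norm_pos_iff.1 hl0)
  · simpa using (tendsto_inv_atTop_zero.comp tendsto_norm_upperInfty).mul_const
      (‖g z‖ + ∫ y in Ioi z, ‖deriv g y‖)

/-- Smooth compactly supported functions are dense in L¹, and the integral is bounded by the L¹ norm
uniformly in λ. -/
theorem tendsto_integral_exp_mul {f : ℝ → ℂ} (hf : Integrable f) (z : ℝ) :
    Tendsto (fun l : ℂ => ∫ y in Ioi z,
      Complex.exp (2 * Complex.I * l * ((y - z : ℝ) : ℂ)) * f y) upperInfty (𝓝 0) := by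
  rw [Metric.tendsto_nhds]
  intro ε hε
  obtain ⟨g, hgs, hgc, hg⟩ := MemLp.exist_eLpNorm_sub_le (p := 1) (by simp) le_rfl
    (memLp_one_iff_integrable.2 hf) (half_pos hε)
  have hgi : Integrable g := hgc.continuous.integrable_of_hasCompactSupport hgs
  have hfg : ∫ y, ‖f y - g y‖ ≤ ε / 2 := by
    rw [eLpNorm_one_eq_lintegral_enorm] at hg
    have := integral_norm_eq_lintegral_enorm (hf.sub hgi).aestronglyMeasurable
    simp only [Pi.sub_apply] at this hg
    rw [this]
    exact ENNReal.toReal_le_of_le_ofReal (half_pos hε).le hg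
  have hlim := tendsto_integral_exp_mul_of_contDiff (hgc.of_le (by simp)) hgs z
  filter_upwards [(Metric.tendsto_nhds.1 hlim) (ε / 2) (half_pos hε), eventually_mem_upperInfty]
    with l hl hlU
  rw [dist_zero_right] at hl ⊢
  have hsub : (∫ y in Ioi z, Complex.exp (2 * Complex.I * l * ((y - z : ℝ) : ℂ)) * f y) =
      (∫ y in Ioi z, Complex.exp (2 * Complex.I * l * ((y - z : ℝ) : ℂ)) * (f y - g y)) +
      ∫ y in Ioi z, Complex.exp (2 * Complex.I * l * ((y - z : ℝ) : ℂ)) * g y := by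
    have := integral_add (integrableOn_exp_mul hlU (hf.sub hgi).integrableOn (z := z))
      (integrableOn_exp_mul hlU hgi.integrableOn)
    simp only [Pi.sub_apply, ← mul_add, sub_add_cancel] at this
    exact this
  have h1 := norm_integral_exp_mul_le hlU (hf.sub hgi).integrableOn (z := z)
  have h2 : ∫ y in Ioi z, ‖(f - g) y‖ ≤ ∫ y, ‖f y - g y‖ :=
    setIntegral_le_integral (hf.sub hgi).norm (Eventually.of_forall fun _ => norm_nonneg _)
  simp only [Pi.sub_apply] at h1 h2
  rw [hsub]
  calc _ ≤ _ := norm_add_le _ _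
    _ < ε := by linarith

/-! ### Volterra equations on half-lines -/

/-- A bounded family of regular functions of the spectral parameter, continuous in position, with
its limit as `l → ∞`. -/
structure RegularFamily (d : ℝ → ℂ → ℂ) (B : ℝ → ℝ) (L : ℝ → ℂ) : Prop where
  bound : ∀ z, ∀ l ∈ closure upperPlane, ‖d z l‖ ≤ B z
  continuous : ∀ l ∈ closure upperPlane, Continuous fun z => d z l
  continuousOn : ∀ z, ContinuousOn (d z) (closure upperPlane)
  differentiableOn : ∀ z, DifferentiableOn ℂ (d z) upperPlane
  tendsto : ∀ z, Tendsto (d z) upperInfty (𝓝 (L z))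

/-- An integrably dominated family of regular functions of the spectral parameter. -/
structure RegularSource (F : ℝ → ℂ → ℂ) (k : ℝ → ℝ) (L : ℝ → ℂ) : Prop where
  integrable : Integrable k
  bound : ∀ z, ∀ l ∈ closure upperPlane, ‖F z l‖ ≤ k z
  measurable : ∀ l ∈ closure upperPlane, AEStronglyMeasurable fun z => F z l
  continuousOn : ∀ z, ContinuousOn (F z) (closure upperPlane)
  differentiableOn : ∀ z, DifferentiableOn ℂ (F z) upperPlane
  tendsto : ∀ z, Tendsto (F z) upperInfty (𝓝 (L z))

/-! ### Integration of regular sources -/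

namespace RegularSource

variable {F : ℝ → ℂ → ℂ} {k : ℝ → ℝ} {L : ℝ → ℂ}

theorem integrable_source (hF : RegularSource F k L) {l : ℂ} (hl : l ∈ closure upperPlane) :
    Integrable fun y => F y l :=
  hF.integrable.mono' (hF.measurable l hl) (Eventually.of_forall fun y => hF.bound y l hl)

theorem integrable_limit (hF : RegularSource F k L) : Integrable L := by
  refine hF.integrable.mono' ?_ (Eventually.of_forall fun y => ?_)
  -- The natural numbers tend to ∞ within the closed half-plane; a sequence is needed for the
  -- measurability of the limit.
  · have hn : Tendsto (fun n : ℕ => ((n : ℝ) : ℂ)) atTop upperInfty :=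
      (tendsto_ofReal_upperInfty (F := atTop)
        (by rw [IsOrderBornology.cobounded_eq]; exact le_sup_right)).comp tendsto_natCast_atTop_atTop
    exact aestronglyMeasurable_of_tendsto_ae (u := atTop) (f := fun (n : ℕ) y => F y ((n : ℝ) : ℂ))
      (fun n => hF.measurable _ (ofReal_mem_closure_upperPlane _))
      (Eventually.of_forall fun y => (hF.tendsto y).comp hn)
  · exact le_of_tendsto (hF.tendsto y).norm
      (eventually_mem_upperInfty.mono fun l hl => hF.bound y l hl)

theorem regularFamily_integral (hF : RegularSource F k L) :
    RegularFamily (fun z l => ∫ y in Ioi z, F y l) (fun z => ∫ y in Ioi z, k y)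
      (fun z => ∫ y in Ioi z, L y) where
  bound _ l hl := norm_integral_le_of_norm_le hF.integrable.integrableOn
    (Eventually.of_forall fun y => hF.bound y l hl)
  continuous _ hl := continuous_integral_Ioi fun _ => (hF.integrable_source hl).integrableOn
  continuousOn _ := continuousOn_of_dominated (bound := k)
    (fun l hl => (hF.measurable l hl).restrict)
    (fun l hl => Eventually.of_forall fun y => hF.bound y l hl) hF.integrable.integrableOn
    (Eventually.of_forall fun y => hF.continuousOn y)
  differentiableOn _ := differentiableOn_integral_of_dominated (G := fun l y => F y l) (k := k)
    hF.integrable.integrableOn (fun l hl => (hF.measurable l (subset_closure hl)).restrict)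
    (Eventually.of_forall fun y l hl => hF.bound y l (subset_closure hl))
    (Eventually.of_forall fun y => hF.differentiableOn y)
  tendsto _ := tendsto_integral_filter_of_dominated_convergence k
    (eventually_mem_upperInfty.mono fun l hl => (hF.measurable l hl).restrict)
    (eventually_mem_upperInfty.mono fun l hl => Eventually.of_forall fun y => hF.bound y l hl)
    hF.integrable.integrableOn (Eventually.of_forall fun y => hF.tendsto y)

theorem integrableOn_exp_two_I_mul {f : ℝ → ℂ} {l : ℂ} (hl : l ∈ closure upperPlane)
    (hf : Integrable f) (a : ℝ) :
    IntegrableOn (fun y : ℝ => Complex.exp (2 * Complex.I * l * y) * f y) (Ioi a) := by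
  refine ((integrableOn_exp_mul hl (hf.integrableOn (s := Ioi a))).const_mul
    (Complex.exp (2 * Complex.I * l * a))).congr (Eventually.of_forall fun y => ?_)
  simp only [← mul_assoc, ← Complex.exp_add]
  congr 2
  push_cast
  ring

theorem integral_exp_mul_eq (f : ℝ → ℂ) (l : ℂ) (z : ℝ) :
    ∫ y in Ioi z, Complex.exp (2 * Complex.I * l * ((y - z : ℝ) : ℂ)) * f y =
      Complex.exp (-(2 * Complex.I * l * z)) *
        ∫ y in Ioi z, Complex.exp (2 * Complex.I * l * y) * f y := by
  rw [← integral_const_mul]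
  congr 1
  ext y
  simp only [← mul_assoc, ← Complex.exp_add]
  congr 2
  push_cast
  ring

theorem regularFamily_integral_exp (hF : RegularSource F k L) :
    RegularFamily
      (fun z l => ∫ y in Ioi z, Complex.exp (2 * Complex.I * l * ((y - z : ℝ) : ℂ)) * F y l)
      (fun z => ∫ y in Ioi z, k y) (fun _ => 0) := by
  have hb : ∀ z : ℝ, ∀ l ∈ closure upperPlane, ∀ y ∈ Ioi z,
      ‖Complex.exp (2 * Complex.I * l * ((y - z : ℝ) : ℂ)) * F y l‖ ≤ k y := by
    intro z l hl y hy
    rw [norm_mul]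
    exact (mul_le_of_le_one_left (norm_nonneg _)
      (norm_exp_two_I_mul_le hl (sub_nonneg.2 (le_of_lt hy)))).trans (hF.bound y l hl)
  have hm : ∀ z : ℝ, ∀ l ∈ closure upperPlane, AEStronglyMeasurable
      (fun y : ℝ => Complex.exp (2 * Complex.I * l * ((y - z : ℝ) : ℂ)) * F y l)
      (volume.restrict (Ioi z)) := fun z l hl =>
    (continuous_exp_kernel l z).aestronglyMeasurable.mul (hF.measurable l hl).restrict
  have hIoi : ∀ z : ℝ, ∀ᵐ y ∂volume.restrict (Ioi z), y ∈ Ioi z := fun z =>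
    self_mem_ae_restrict measurableSet_Ioi
  refine ⟨fun z l hl => ?_, fun l hl => ?_, fun z => ?_, fun z => ?_, fun z => ?_⟩
  · exact norm_integral_le_of_norm_le hF.integrable.integrableOn ((hIoi z).mono (hb z l hl))
  -- Here `z` enters both the domain and the kernel. Factoring out e^{-2iλz} leaves an ordinary tail
  -- integral.
  · rw [show (fun z : ℝ => ∫ y in Ioi z,
      Complex.exp (2 * Complex.I * l * ((y - z : ℝ) : ℂ)) * F y l) = _ from
        funext (integral_exp_mul_eq (fun y => F y l) l)]
    exact (by fun_prop : Continuous fun z : ℝ => Complex.exp (-(2 * Complex.I * l * z))).mul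
      (continuous_integral_Ioi (integrableOn_exp_two_I_mul hl (hF.integrable_source hl)))
  · refine continuousOn_of_dominated (bound := k) (hm z)
      (fun l hl => (hIoi z).mono (hb z l hl)) hF.integrable.integrableOn
      (Eventually.of_forall fun y => ?_)
    exact (by fun_prop : Continuous fun l : ℂ =>
      Complex.exp (2 * Complex.I * l * ((y - z : ℝ) : ℂ))).continuousOn.mul (hF.continuousOn y)
  · refine differentiableOn_integral_of_dominated
      (G := fun l y => Complex.exp (2 * Complex.I * l * ((y - z : ℝ) : ℂ)) * F y l) (k := k)
      hF.integrable.integrableOn (fun l hl => hm z l (subset_closure hl))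
      ((hIoi z).mono fun y hy l hl => hb z l (subset_closure hl) y hy)
      (Eventually.of_forall fun y => ?_)
    exact (by fun_prop : Differentiable ℂ fun l : ℂ =>
      Complex.exp (2 * Complex.I * l * ((y - z : ℝ) : ℂ))).differentiableOn.mul
        (hF.differentiableOn y)
  -- The source varies with λ, so Riemann-Lebesgue applies to its limit `L` only; the remainder `F -
  -- L` tends to 0 in L¹ by dominated convergence.
  · have hL := hF.integrable_limit
    have h1 := tendsto_integral_exp_mul hL z
    have h2 : Tendsto (fun l : ℂ => ∫ y in Ioi z, ‖F y l - L y‖) upperInfty (𝓝 0) := by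
      have := tendsto_integral_filter_of_dominated_convergence
        (μ := volume.restrict (Ioi z)) (l := upperInfty) (F := fun l y => ‖F y l - L y‖)
        (f := fun _ => (0 : ℝ))
        (fun y => k y + ‖L y‖)
        (eventually_mem_upperInfty.mono fun l hl =>
          ((hF.measurable l hl).sub hL.aestronglyMeasurable).norm.restrict)
        (eventually_mem_upperInfty.mono fun l hl => Eventually.of_forall fun y => by
          rw [norm_norm]
          exact (norm_sub_le _ _).trans (add_le_add_left (hF.bound y l hl) _))
        (hF.integrable.add hL.norm).integrableOn
        (Eventually.of_forall fun y => by
          simpa using ((hF.tendsto y).sub_const (L y)).norm)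
      simpa using this
    have h3 : Tendsto (fun l : ℂ => ∫ y in Ioi z,
        Complex.exp (2 * Complex.I * l * ((y - z : ℝ) : ℂ)) * (F y l - L y)) upperInfty (𝓝 0) :=
      squeeze_zero_norm' (eventually_mem_upperInfty.mono fun l hl =>
        norm_integral_exp_mul_le hl ((hF.integrable_source hl).sub hL).integrableOn) h2
    rw [← add_zero (0 : ℂ)]
    refine (h3.add h1).congr' (eventually_mem_upperInfty.mono fun l hl => ?_)
    have := integral_add
      (integrableOn_exp_mul hl ((hF.integrable_source hl).sub hL).integrableOn (z := z))
      (integrableOn_exp_mul hl hL.integrableOn)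
    simp only [Pi.sub_apply, ← mul_add, sub_add_cancel] at this
    exact this.symm

end RegularSource

theorem RegularFamily.neg {d : ℝ → ℂ → ℂ} {B : ℝ → ℝ} {L : ℝ → ℂ} (hd : RegularFamily d B L) :
    RegularFamily (fun z l => -d z l) B (fun z => -L z) where
  bound z l hl := by rw [norm_neg]; exact hd.bound z l hl
  continuous l hl := (hd.continuous l hl).neg
  continuousOn z := (hd.continuousOn z).neg
  differentiableOn z := (hd.differentiableOn z).neg
  tendsto z := (hd.tendsto z).neg

/-- The diagonal kernel of the Volterra equation. -/
noncomputable def volterraKernel (i : Fin 2) (l : ℂ) (t : ℝ) : ℂ :=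
  if i = 0 then 1 else Complex.exp (2 * Complex.I * l * t)

theorem RegularSource.regularFamily_volterra {F : ℝ → ℂ → ℂ} {k : ℝ → ℝ} {L : ℝ → ℂ}
    (hF : RegularSource F k L) (i : Fin 2) : ∃ L' : ℝ → ℂ, (i = 1 → L' = fun _ => 0) ∧
      RegularFamily (fun z l => -∫ y in Ioi z, volterraKernel i l (y - z) * F y l)
        (fun z => ∫ y in Ioi z, k y) L' := by
  fin_cases i
  · refine ⟨fun z => -∫ y in Ioi z, L y, by simp, ?_⟩
    · simp only [volterraKernel, Fin.zero_eta, Fin.isValue, if_true, one_mul]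
      exact hF.regularFamily_integral.neg
  · refine ⟨_, fun _ => funext fun z => neg_zero, ?_⟩
    simpa [volterraKernel] using hF.regularFamily_integral_exp.neg

/-- The terms of the Neumann series of the Volterra equation. -/
noncomputable def volterraTerm (w : Fin 2 → Fin 2 → ℝ → ℂ) : ℕ → Fin 2 → ℝ → ℂ → ℂ
  | 0, i => fun _ _ => ![1, 0] i
  | n + 1, i => fun z l => -∫ y in Ioi z, volterraKernel i l (y - z) *
      ∑ j, w i j y * volterraTerm w n j y l

section Volterra

variable {w : Fin 2 → Fin 2 → ℝ → ℂ}

/-- This is half of the induction on the Neumann series: integrable coefficients turn a regular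
family into a regular source, and `RegularSource.regularFamily_volterra` turns the source back into
a family. -/
theorem RegularFamily.regularSource (hw : ∀ i j, Integrable (w i j)) {k : ℝ → ℝ}
    (hk : Integrable k) (hwk : ∀ i y, ∑ j, ‖w i j y‖ ≤ k y) {d : Fin 2 → ℝ → ℂ → ℂ} {B : ℝ → ℝ}
    {L : Fin 2 → ℝ → ℂ} (hd : ∀ j, RegularFamily (d j) B (L j)) (hB : Continuous B) {C : ℝ}
    (hBC : ∀ z, B z ≤ C) (i : Fin 2) :
    RegularSource (fun y l => ∑ j, w i j y * d j y l) (fun y => k y * B y)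
      (fun y => ∑ j, w i j y * L j y) where
  integrable := hk.mul_bdd (c := C) hB.aestronglyMeasurable (Eventually.of_forall fun y => by
    have := (norm_nonneg _).trans ((hd 0).bound y 0 (ofReal_mem_closure_upperPlane 0))
    rw [Real.norm_of_nonneg this]
    exact hBC y)
  bound y l hl := by
    have hB0 := (norm_nonneg _).trans ((hd 0).bound y 0 (ofReal_mem_closure_upperPlane 0))
    refine (norm_sum_le _ _).trans ?_
    calc ∑ j, ‖w i j y * d j y l‖ ≤ ∑ j, ‖w i j y‖ * B y := by
          refine Finset.sum_le_sum fun j _ => ?_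
          rw [norm_mul]
          exact mul_le_mul_of_nonneg_left ((hd j).bound y l hl) (norm_nonneg _)
      _ = (∑ j, ‖w i j y‖) * B y := (Finset.sum_mul _ _ _).symm
      _ ≤ k y * B y := mul_le_mul_of_nonneg_right (hwk i y) hB0
  measurable l hl := by
    simp only [Fin.sum_univ_two]
    exact ((hw i 0).aestronglyMeasurable.mul ((hd 0).continuous l hl).aestronglyMeasurable).add
      ((hw i 1).aestronglyMeasurable.mul ((hd 1).continuous l hl).aestronglyMeasurable)
  continuousOn y := continuousOn_finsetSum _ fun j _ =>
    continuousOn_const.mul ((hd j).continuousOn y)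
  differentiableOn y := DifferentiableOn.fun_sum fun j _ =>
    ((hd j).differentiableOn y).const_mul _
  tendsto y := tendsto_finsetSum _ fun j _ => ((hd j).tendsto y).const_mul _

/-- The weight `k` is free of λ, so each integration improves the bound by the next factor of the
exponential series, uniformly in λ. The oscillating kernel makes the limit of the second component
vanish at every positive order, and at order 0 that component is 0 already. -/
theorem regularFamily_volterraTerm (hw : ∀ i j, Integrable (w i j)) {k : ℝ → ℝ}
    (hk : Integrable k) (hwk : ∀ i y, ∑ j, ‖w i j y‖ ≤ k y) (n : ℕ) :
    ∃ L : Fin 2 → ℝ → ℂ, (∀ z, L 1 z = 0) ∧ ∀ i, RegularFamily (volterraTerm w n i)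
      (fun z => (∫ y in Ioi z, k y) ^ n / n.factorial) (L i) := by
  have hk0 : ∀ y, 0 ≤ k y := fun y =>
    (Finset.sum_nonneg fun j _ => norm_nonneg (w 0 j y)).trans (hwk 0 y)
  have hNM : ∀ z, ∫ y in Ioi z, k y ≤ ∫ y, k y := fun z =>
    setIntegral_le_integral hk (Eventually.of_forall hk0)
  have hN0 : ∀ z, 0 ≤ ∫ y in Ioi z, k y := fun z => integral_nonneg fun y => hk0 y
  induction n with
  | zero =>
    refine ⟨fun i _ => ![1, 0] i, fun z => by simp, fun i => ?_⟩
    refine ⟨fun z l _ => ?_, fun l _ => continuous_const, fun z => continuousOn_const,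
      fun z => differentiableOn_const _, fun z => tendsto_const_nhds⟩
    fin_cases i <;> simp [volterraTerm]
  | succ n ih =>
    obtain ⟨L, -, hL⟩ := ih
    have hsrc := RegularFamily.regularSource hw hk hwk hL
      (((continuous_integral_Ioi fun a => hk.integrableOn).pow n).div_const _)
      (C := (∫ y, k y) ^ n / n.factorial) (fun z =>
        div_le_div_of_nonneg_right (pow_le_pow_left₀ (hN0 z) (hNM z) n) (by positivity))
    choose L' hL'0 hL' using fun i => (hsrc i).regularFamily_volterra i
    refine ⟨L', fun z => by rw [hL'0 1 rfl], fun i => ?_⟩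
    have := hL' i
    simp only [integral_Ioi_mul_pow hk n] at this
    exact this

/-- Solvability of the Volterra equation, with regular dependence on the spectral parameter. -/
theorem exists_volterra_solution (hw : ∀ i j, Integrable (w i j)) :
    ∃ (h : Fin 2 → ℝ → ℂ → ℂ) (C : ℝ) (L : Fin 2 → ℝ → ℂ), (∀ z, L 1 z = 0) ∧
      (∀ i, RegularFamily (h i) (fun _ => C) (L i)) ∧
      ∀ i z, ∀ l ∈ closure upperPlane, h i z l =
        ![1, 0] i - ∫ y in Ioi z, volterraKernel i l (y - z) * ∑ j, w i j y * h j y l := by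
  -- A single weight that dominates both rows of the coefficient matrix.
  set k : ℝ → ℝ := fun y => ∑ i, ∑ j, ‖w i j y‖
  have hk : Integrable k := integrable_finsetSum _ fun i _ => integrable_finsetSum _ fun j _ =>
    (hw i j).norm
  have hwk : ∀ i y, ∑ j, ‖w i j y‖ ≤ k y := fun i y =>
    Finset.single_le_sum (f := fun i => ∑ j, ‖w i j y‖)
      (fun i _ => Finset.sum_nonneg fun j _ => norm_nonneg _) (Finset.mem_univ i)
  have hk0 : ∀ y, 0 ≤ k y := fun y => Finset.sum_nonneg fun i _ =>
    Finset.sum_nonneg fun j _ => norm_nonneg (w i j y)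
  set M : ℝ := ∫ y, k y with hM
  have hN0 : ∀ z, 0 ≤ ∫ y in Ioi z, k y := fun z => integral_nonneg fun y => hk0 y
  have hNM : ∀ z, ∫ y in Ioi z, k y ≤ M := fun z =>
    setIntegral_le_integral hk (Eventually.of_forall hk0)
  choose Λ hΛ0 hΛ using regularFamily_volterraTerm hw hk hwk
  have hsum : Summable fun n : ℕ => M ^ n / n.factorial := Real.summable_pow_div_factorial M
  have hbd : ∀ n i z, ∀ l ∈ closure upperPlane,
      ‖volterraTerm w n i z l‖ ≤ M ^ n / n.factorial := fun n i z l hl =>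
    ((hΛ n i).bound z l hl).trans 
      (div_le_div_of_nonneg_right (pow_le_pow_left₀ (hN0 z) (hNM z) n) (by positivity))
  have hterm : ∀ i z, ∀ l ∈ closure upperPlane, Summable fun n => volterraTerm w n i z l :=
    fun i z l hl => Summable.of_norm_bounded hsum fun n => hbd n i z l hl
  refine ⟨fun i z l => ∑' n, volterraTerm w n i z l, ∑' n : ℕ, M ^ n / n.factorial,
    fun i z => ∑' n, Λ n i z, fun z => by simp [hΛ0], fun i => ?_, fun i z l hl => ?_⟩
  · refine ⟨fun z l hl => ?_, fun l hl => ?_, fun z => ?_, fun z => ?_, fun z => ?_⟩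
    · exact tsum_of_norm_bounded hsum.hasSum fun n => hbd n i z l hl
    · exact continuous_tsum (fun n => (hΛ n i).continuous l hl) hsum fun n z => hbd n i z l hl
    · exact continuousOn_tsum (fun n => (hΛ n i).continuousOn z) hsum
        fun n l hl => hbd n i z l hl
    · exact Complex.differentiableOn_tsum_of_summable_norm hsum
        (fun n => (hΛ n i).differentiableOn z)
        isOpen_upperPlane fun n l hl => hbd n i z l (subset_closure hl)
    · exact tendsto_tsum_of_dominated_convergence hsum (fun n => (hΛ n i).tendsto z)
        (eventually_mem_upperInfty.mono fun l hl n => hbd n i z l hl)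
  · have hker : ∀ y ∈ Ioi z, ‖volterraKernel i l (y - z)‖ ≤ 1 := by
      intro y hy
      unfold volterraKernel
      split_ifs
      · simp
      · exact norm_exp_two_I_mul_le hl (sub_nonneg.2 (le_of_lt hy))
    have hkc : Continuous fun y => volterraKernel i l (y - z) := by
      unfold volterraKernel
      split_ifs
      · exact continuous_const
      · exact continuous_exp_kernel l z
    have hIoi : ∀ᵐ y ∂volume.restrict (Ioi z), y ∈ Ioi z := self_mem_ae_restrict measurableSet_Ioi
    have hFb : ∀ n, ∀ y ∈ Ioi z, ‖volterraKernel i l (y - z) *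
        ∑ j, w i j y * volterraTerm w n j y l‖ ≤ k y * (M ^ n / n.factorial) := by
      intro n y hy
      rw [norm_mul]
      refine (mul_le_of_le_one_left (norm_nonneg _) (hker y hy)).trans ?_
      refine (norm_sum_le _ _).trans ?_
      calc ∑ j, ‖w i j y * volterraTerm w n j y l‖
          ≤ ∑ j, ‖w i j y‖ * (M ^ n / n.factorial) := by
            refine Finset.sum_le_sum fun j _ => ?_
            rw [norm_mul]
            exact mul_le_mul_of_nonneg_left (hbd n j y l hl) (norm_nonneg _)
        _ = (∑ j, ‖w i j y‖) * (M ^ n / n.factorial) := (Finset.sum_mul _ _ _).symm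
        _ ≤ k y * (M ^ n / n.factorial) :=
            mul_le_mul_of_nonneg_right (hwk i y) ((norm_nonneg _).trans (hbd n i y l hl))
    have hFi : ∀ n, IntegrableOn (fun y => volterraKernel i l (y - z) *
        ∑ j, w i j y * volterraTerm w n j y l) (Ioi z) := by
      intro n
      refine (hk.mul_const (M ^ n / n.factorial)).integrableOn.mono' ?_ (hIoi.mono (hFb n))
      refine hkc.aestronglyMeasurable.mul ?_
      simp only [Fin.sum_univ_two]
      exact (((hw i 0).aestronglyMeasurable.mul
        ((hΛ n 0).continuous l hl).aestronglyMeasurable).add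
        ((hw i 1).aestronglyMeasurable.mul
          ((hΛ n 1).continuous l hl).aestronglyMeasurable)).restrict
    -- The L¹ norms are at most `M * (M ^ n / n!)`, which allows the sum and the integral to be
    -- exchanged.
    have hS := hasSum_integral_of_summable_integral_norm hFi (by
      refine Summable.of_nonneg_of_le (fun n => integral_nonneg fun y => norm_nonneg _)
        (fun n => ?_) (hsum.mul_left M)
      calc _ ≤ ∫ y in Ioi z, k y * (M ^ n / n.factorial) :=
            integral_mono_ae (hFi n).norm (hk.mul_const _).integrableOn (hIoi.mono (hFb n))
        _ = (∫ y in Ioi z, k y) * (M ^ n / n.factorial) := integral_mul_const _ _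
        _ ≤ M * (M ^ n / n.factorial) :=
            mul_le_mul_of_nonneg_right (hNM z) ((norm_nonneg _).trans (hbd n i z l hl)))
    have hpt : ∀ y, ∑' n, volterraKernel i l (y - z) * ∑ j, w i j y * volterraTerm w n j y l =
        volterraKernel i l (y - z) * ∑ j, w i j y * ∑' n, volterraTerm w n j y l := fun y =>
      ((hasSum_sum fun j _ => ((hterm j y l hl).hasSum.mul_left (w i j y))).mul_left _).tsum_eq
    simp only [hpt] at hS
    change ∑' n, volterraTerm w n i z l = ![1, 0] i - ∫ y in Ioi z, volterraKernel i l (y - z) *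
      ∑ j, w i j y * ∑' n, volterraTerm w n j y l
    rw [(hterm i z l hl).tsum_eq_zero_add, sub_eq_add_neg, ← hS.tsum_eq, ← tsum_neg]
    rfl

end Volterra

/-! ### Admissible potentials -/

variable {m : ℝ → EuclideanSpace ℝ (Fin 3)}

theorem Admissible.continuous_apply (hm : Admissible m) (i : Fin 3) :
    Continuous fun z => m z i := by
  rw [continuous_iff_continuousAt]
  intro z
  refine (hm.absolutelyContinuous i (z - 1) (z + 1)).continuousOn.continuousAt ?_
  rw [uIcc_of_le (by linarith)]
  exact Icc_mem_nhds (by linarith) (by linarith)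

theorem Admissible.eq_add_integral (hm : Admissible m) (i : Fin 3) (z : ℝ) :
    m z i = m 0 i + ∫ t in (0 : ℝ)..z, deriv (fun z => m z i) t := by
  rw [(hm.absolutelyContinuous i 0 z).integral_deriv_eq_sub]
  ring

/-- Reflection invariance lets every statement at -∞ be read off from the one at +∞. -/
theorem Admissible.comp_neg (hm : Admissible m) : Admissible fun z => m (-z) where
  norm_eq_one z := hm.norm_eq_one _
  integrable_sub i := (hm.integrable_sub i).comp_neg
  absolutelyContinuous i x y := by
    have hI : ∀ a b, IntervalIntegrable (fun t => deriv (fun z => m z i) (-t)) volume a b :=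
      fun a b => (hm.integrable_deriv i).comp_neg.intervalIntegrable
    have : (fun z => m (-z) i) =
        fun z => m 0 i + -1 * ∫ t in (0 : ℝ)..z, deriv (fun z => m z i) (-t) := by
      ext z
      rw [hm.eq_add_integral i (-z), intervalIntegral.integral_comp_neg, neg_zero,
        intervalIntegral.integral_symm (-z) 0, neg_one_mul]
    rw [this]
    refine AbsolutelyContinuousOnInterval.fun_add
      ((LipschitzWith.const _).lipschitzOnWith (s := uIcc x y)).absolutelyContinuousOnInterval
      (AbsolutelyContinuousOnInterval.const_mul _ ?_)
    refine ((hI _ _).absolutelyContinuousOnInterval_intervalIntegral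
      (a := min 0 (min x y)) (b := max 0 (max x y)) (c := 0)
      (by rw [uIcc_of_le] <;> simp)).mono ?_
    rw [uIcc_of_le (a := min 0 (min x y)) (by simp)]
    exact uIcc_subset_Icc (by simp) (by simp)
  ae_differentiable := by
    have := (Measure.measurePreserving_neg (volume : Measure ℝ)).quasiMeasurePreserving.ae
      hm.ae_differentiable
    filter_upwards [this] with z hz
    exact hz.comp z differentiableAt_id.neg
  integrable_deriv i := by
    have : (deriv fun z => m (-z) i) = fun z => -deriv (fun z => m z i) (-z) := by
      ext z
      exact deriv_comp_neg (fun z => m z i) z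
    rw [this]
    exact (hm.integrable_deriv i).comp_neg.neg
  neg_one_lt z := hm.neg_one_lt _

/-- Integrability of the derivative gives a limit, and integrability of `m - e₃` over a half-line of
infinite measure forces it to be `e₃`. -/
theorem Admissible.tendsto_atTop (hm : Admissible m) (i : Fin 3) :
    Tendsto (fun z => m z i) atTop (𝓝 (e₃ i)) := by
  have h1 := (intervalIntegral_tendsto_integral_Ioi 0
    (hm.integrable_deriv i).integrableOn tendsto_id).const_add (m 0 i)
  have h2 := h1.congr fun z => (hm.eq_add_integral i z).symm
  have h3 := IntegrableAtFilter.eq_zero_of_tendsto (l := atTop) (μ := volume)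
    ⟨univ, univ_mem, (hm.integrable_sub i).integrableOn⟩ (fun s hs => by
      obtain ⟨a, ha⟩ := mem_atTop_sets.1 hs
      exact measure_mono_top (fun x hx => ha x hx) (Real.volume_Ici (a := a)))
    (h2.sub_const (e₃ i))
  rwa [sub_eq_zero.1 h3] at h2

theorem Admissible.tendsto_atBot (hm : Admissible m) (i : Fin 3) :
    Tendsto (fun z => m z i) atBot (𝓝 (e₃ i)) := by
  have := (hm.comp_neg.tendsto_atTop i).comp tendsto_neg_atBot_atTop
  simpa [Function.comp_def] using this

/-- Near both ends m₃ is close to 1, and on the compact interval in between the continuous function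
1 + m₃ attains a positive minimum. -/
theorem Admissible.exists_pos_le (hm : Admissible m) : ∃ δ > 0, ∀ z, δ ≤ 1 + m z 2 := by
  have h1 : ∀ᶠ z in atTop, 1 ≤ 1 + m z 2 := by
    filter_upwards [(hm.tendsto_atTop 2).eventually (lt_mem_nhds (a := 0) (by simp [e₃]))] with z hz
    linarith
  have h2 : ∀ᶠ z in atBot, 1 ≤ 1 + m z 2 := by
    filter_upwards [(hm.tendsto_atBot 2).eventually (lt_mem_nhds (a := 0) (by simp [e₃]))] with z hz
    linarith
  obtain ⟨b, hb⟩ := eventually_atTop.1 h1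
  obtain ⟨a, ha⟩ := eventually_atBot.1 h2
  obtain ⟨x, -, hx⟩ := (isCompact_uIcc (a := a) (b := b)).exists_isMinOn nonempty_uIcc
    ((hm.continuous_apply 2).const_add 1).continuousOn
  refine ⟨min 1 (1 + m x 2), lt_min one_pos (by linarith [hm.neg_one_lt x]), fun z => ?_⟩
  by_cases hz : z ∈ uIcc a b
  · exact (min_le_right _ _).trans (hx hz)
  · refine (min_le_left _ _).trans ?_
    rcases le_total z a with h | h
    · exact ha z h
    · refine hb z ?_
      by_contra h'
      exact hz (Icc_subset_uIcc ⟨h, (not_le.1 h').le⟩)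

theorem sq_add_sq_add_sq_eq_one {v : EuclideanSpace ℝ (Fin 3)} (hv : ‖v‖ = 1) :
    v 0 ^ 2 + v 1 ^ 2 + v 2 ^ 2 = 1 := by
  have := EuclideanSpace.real_norm_sq_eq v
  rw [hv, Fin.sum_univ_three] at this
  linarith

theorem Admissible.ae_hasDerivAt (hm : Admissible m) (i : Fin 3) :
    ∀ᵐ z, HasDerivAt (fun z => (m z i : ℂ)) (deriv (fun z => m z i) z : ℝ) z := by
  filter_upwards [hm.ae_differentiable] with z hz
  have : DifferentiableAt ℝ (fun z => m z i) z :=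
    (EuclideanSpace.proj (𝕜 := ℝ) i).differentiableAt.comp z hz
  exact this.hasDerivAt.ofReal_comp

/-! ### The linear system in components -/

/-- `f' = i l (m · σ) f`. -/
def IsSolution (m : ℝ → EuclideanSpace ℝ (Fin 3)) (l : ℂ) (f : ℝ → Fin 2 → ℂ) : Prop :=
  ∀ z, HasDerivAt f (((Complex.I * l) • pauliDot (m z)).mulVec (f z)) z

theorem isSolution_iff {l : ℂ} {f : ℝ → Fin 2 → ℂ} : IsSolution m l f ↔ ∀ z,
    HasDerivAt (fun z => f z 0) (Complex.I * l * ((m z 2 : ℂ) * f z 0 +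
      ((m z 0 : ℂ) - Complex.I * (m z 1 : ℂ)) * f z 1)) z ∧
    HasDerivAt (fun z => f z 1) (Complex.I * l * (((m z 0 : ℂ) + Complex.I * (m z 1 : ℂ)) * f z 0 -
      (m z 2 : ℂ) * f z 1)) z := by
  refine forall_congr' fun z => ?_
  rw [hasDerivAt_pi, Fin.forall_fin_two]
  have h0 : ((Complex.I * l) • pauliDot (m z)).mulVec (f z) 0 = Complex.I * l *
      ((m z 2 : ℂ) * f z 0 + ((m z 0 : ℂ) - Complex.I * (m z 1 : ℂ)) * f z 1) := by
    simp [pauliDot, σ₁, σ₂, σ₃, Matrix.mulVec, dotProduct, Fin.sum_univ_two]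
    ring
  have h1 : ((Complex.I * l) • pauliDot (m z)).mulVec (f z) 1 = Complex.I * l *
      (((m z 0 : ℂ) + Complex.I * (m z 1 : ℂ)) * f z 0 - (m z 2 : ℂ) * f z 1) := by
    simp [pauliDot, σ₁, σ₂, σ₃, Matrix.mulVec, dotProduct, Fin.sum_univ_two]
    ring
  rw [h0, h1]

/-! ### The gauge transformation diagonalizing `m · σ` -/

/-- The gauge matrix `V` with `V σ₃ V⁻¹ = m · σ` has the entries `gaugeDiag`, `∓ gaugeOff`. -/
noncomputable def gaugeDiag (m : ℝ → EuclideanSpace ℝ (Fin 3)) (z : ℝ) : ℂ := (1 + (m z 2 : ℂ)) / 2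

noncomputable def gaugeOff (s : ℂ) (m : ℝ → EuclideanSpace ℝ (Fin 3)) (z : ℝ) : ℂ :=
  ((m z 0 : ℂ) + s * Complex.I * (m z 1 : ℂ)) / 2

noncomputable def gaugeDiagDeriv (m : ℝ → EuclideanSpace ℝ (Fin 3)) (z : ℝ) : ℂ :=
  (deriv (fun z => m z 2) z : ℝ) / 2

noncomputable def gaugeOffDeriv (s : ℂ) (m : ℝ → EuclideanSpace ℝ (Fin 3)) (z : ℝ) : ℂ :=
  ((deriv (fun z => m z 0) z : ℝ) + s * Complex.I * (deriv (fun z => m z 1) z : ℝ)) / 2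

/-- The matrix `-V⁻¹ V'`. -/
noncomputable def gaugePotential (m : ℝ → EuclideanSpace ℝ (Fin 3)) (i j : Fin 2) (z : ℝ) : ℂ :=
  -((gaugeDiag m z)⁻¹ * !![
    gaugeDiag m z * gaugeDiagDeriv m z + gaugeOff (-1) m z * gaugeOffDeriv 1 m z,
    gaugeOff (-1) m z * gaugeDiagDeriv m z - gaugeDiag m z * gaugeOffDeriv (-1) m z;
    gaugeDiag m z * gaugeOffDeriv 1 m z - gaugeOff 1 m z * gaugeDiagDeriv m z,
    gaugeDiag m z * gaugeDiagDeriv m z + gaugeOff 1 m z * gaugeOffDeriv (-1) m z] i j)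

section Gauge

variable (hm : Admissible m)
include hm

/-- This is |m| = 1 in disguise. It says that the gauge matrix has determinant `gaugeDiag`, and it
is the identity behind (m·σ)V = Vσ₃. -/
theorem gauge_relation (z : ℝ) :
    gaugeDiag m z ^ 2 + gaugeOff 1 m z * gaugeOff (-1) m z = gaugeDiag m z := by
  have h : (m z 0 : ℂ) ^ 2 + (m z 1 : ℂ) ^ 2 + (m z 2 : ℂ) ^ 2 = 1 := by
    have := congrArg Complex.ofReal (sq_add_sq_add_sq_eq_one (hm.norm_eq_one z))
    simpa only [Complex.ofReal_add, Complex.ofReal_pow, Complex.ofReal_one] using this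
  simp only [gaugeDiag, gaugeOff]
  linear_combination h / 4 - (m z 1 : ℂ) ^ 2 / 4 * Complex.I_sq

theorem gaugeDiag_ne_zero (z : ℝ) : gaugeDiag m z ≠ 0 := by
  have h : gaugeDiag m z = (((1 + m z 2) / 2 : ℝ) : ℂ) := by simp [gaugeDiag]
  rw [h, Complex.ofReal_ne_zero]
  linarith [hm.neg_one_lt z]

theorem continuous_gaugeDiag : Continuous (gaugeDiag m) := by
  exact (continuous_const.add
    (Complex.continuous_ofReal.comp (hm.continuous_apply 2))).div_const 2

theorem continuous_gaugeOff (s : ℂ) : Continuous (gaugeOff s m) := by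
  exact ((Complex.continuous_ofReal.comp (hm.continuous_apply 0)).add
    (continuous_const.mul (Complex.continuous_ofReal.comp (hm.continuous_apply 1)))).div_const 2

theorem absolutelyContinuousOnInterval_gaugeDiag (a b : ℝ) :
    AbsolutelyContinuousOnInterval (gaugeDiag m) a b := by
  have := (((LipschitzWith.const (1 : ℂ)).lipschitzOnWith
    (s := uIcc a b)).absolutelyContinuousOnInterval.fun_add
    (absolutelyContinuousOnInterval_ofReal (hm.absolutelyContinuous 2 a b))).const_smul (1 / 2 : ℂ)
  refine (congrArg (AbsolutelyContinuousOnInterval · a b) (funext fun z => ?_)).mpr this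
  simp only [gaugeDiag, smul_eq_mul]
  ring

theorem absolutelyContinuousOnInterval_gaugeOff (s : ℂ) (a b : ℝ) :
    AbsolutelyContinuousOnInterval (gaugeOff s m) a b := by
  have := ((absolutelyContinuousOnInterval_ofReal (hm.absolutelyContinuous 0 a b)).fun_add
    ((absolutelyContinuousOnInterval_ofReal (hm.absolutelyContinuous 1 a b)).const_smul
      (s * Complex.I))).const_smul (1 / 2 : ℂ)
  refine (congrArg (AbsolutelyContinuousOnInterval · a b) (funext fun z => ?_)).mpr this
  simp only [gaugeOff, smul_eq_mul]
  ring

theorem ae_hasDerivAt_gaugeDiag :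
    ∀ᵐ z, HasDerivAt (gaugeDiag m) (gaugeDiagDeriv m z) z := by
  filter_upwards [hm.ae_hasDerivAt 2] with z hz
  exact (hz.const_add 1).div_const 2

theorem ae_hasDerivAt_gaugeOff (s : ℂ) :
    ∀ᵐ z, HasDerivAt (gaugeOff s m) (gaugeOffDeriv s m z) z := by
  filter_upwards [hm.ae_hasDerivAt 0, hm.ae_hasDerivAt 1] with z h0 h1
  exact (h0.add (h1.const_mul (s * Complex.I))).div_const 2

theorem Admissible.norm_apply_le (z : ℝ) (i : Fin 3) : ‖(m z i : ℂ)‖ ≤ 1 := by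
  rw [Complex.norm_real, ← hm.norm_eq_one z]
  exact PiLp.norm_apply_le (m z) i

theorem norm_gaugeDiag_le (z : ℝ) : ‖gaugeDiag m z‖ ≤ 1 := by
  rw [gaugeDiag, norm_div, Complex.norm_ofNat]
  have := (norm_add_le (1 : ℂ) (m z 2 : ℂ)).trans (add_le_add norm_one.le (hm.norm_apply_le z 2))
  linarith

theorem norm_gaugeOff_le {s : ℂ} (hs : ‖s‖ ≤ 1) (z : ℝ) : ‖gaugeOff s m z‖ ≤ 1 := by
  rw [gaugeOff, norm_div, Complex.norm_ofNat]
  have h1 : ‖s * Complex.I * (m z 1 : ℂ)‖ ≤ 1 := by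
    rw [norm_mul, norm_mul, Complex.norm_I, mul_one]
    exact mul_le_one₀ hs (norm_nonneg _) (hm.norm_apply_le z 1)
  have := (norm_add_le (m z 0 : ℂ) (s * Complex.I * (m z 1 : ℂ))).trans
    (add_le_add (hm.norm_apply_le z 0) h1)
  linarith

theorem tendsto_gaugeDiag_atTop : Tendsto (gaugeDiag m) atTop (𝓝 1) := by
  have := (((Complex.continuous_ofReal.tendsto _).comp (hm.tendsto_atTop 2)).const_add
    (1 : ℂ)).div_const 2
  have h : ((1 : ℂ) + (e₃ 2 : ℝ)) / 2 = 1 := by simp [e₃]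
  rw [h] at this
  exact this

theorem tendsto_gaugeOff_atTop (s : ℂ) : Tendsto (gaugeOff s m) atTop (𝓝 0) := by
  have := (((Complex.continuous_ofReal.tendsto _).comp (hm.tendsto_atTop 0)).add
    (((Complex.continuous_ofReal.tendsto _).comp (hm.tendsto_atTop 1)).const_mul
      (s * Complex.I))).div_const 2
  have h : (((e₃ 0 : ℝ) : ℂ) + s * Complex.I * (e₃ 1 : ℝ)) / 2 = 0 := by simp [e₃]
  rw [h] at this
  exact this

/-- `V W = -V'` for the gauge potential `W`. -/
theorem gauge_mul_gaugePotential (z : ℝ) :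
    gaugeDiag m z * gaugePotential m 0 0 z - gaugeOff (-1) m z * gaugePotential m 1 0 z =
      -gaugeDiagDeriv m z ∧
    gaugeDiag m z * gaugePotential m 0 1 z - gaugeOff (-1) m z * gaugePotential m 1 1 z =
      gaugeOffDeriv (-1) m z ∧
    gaugeOff 1 m z * gaugePotential m 0 0 z + gaugeDiag m z * gaugePotential m 1 0 z =
      -gaugeOffDeriv 1 m z ∧
    gaugeOff 1 m z * gaugePotential m 0 1 z + gaugeDiag m z * gaugePotential m 1 1 z =
      -gaugeDiagDeriv m z := by
  have hrel := gauge_relation hm z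
  have hne := gaugeDiag_ne_zero hm z
  simp only [gaugePotential, Matrix.of_apply, Matrix.cons_val', Matrix.cons_val_zero,
    Matrix.cons_val_one, Matrix.cons_val_fin_one]
  refine ⟨?_, ?_, ?_, ?_⟩ <;> field_simp
  · linear_combination -gaugeDiagDeriv m z * hrel
  · linear_combination gaugeOffDeriv (-1) m z * hrel
  · linear_combination -gaugeOffDeriv 1 m z * hrel
  · linear_combination -gaugeDiagDeriv m z * hrel

/-- Every entry is a bounded continuous factor times an entry of m'. The assumption m₃ > -1 is what
bounds the inverse of `gaugeDiag`, through `Admissible.exists_pos_le`. -/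
theorem integrable_gaugePotential (i j : Fin 2) : Integrable (gaugePotential m i j) := by
  obtain ⟨δ, hδ, hδm⟩ := hm.exists_pos_le
  have hp : Integrable (gaugeDiagDeriv m) := (hm.integrable_deriv 2).ofReal.div_const 2
  have hq : ∀ s, Integrable (gaugeOffDeriv s m) := fun s =>
    ((hm.integrable_deriv 0).ofReal.add ((hm.integrable_deriv 1).ofReal.const_mul _)).div_const 2
  have hpi : ∀ z, ‖(gaugeDiag m z)⁻¹‖ ≤ 2 / δ := by
    intro z
    have h1 : gaugeDiag m z = (((1 + m z 2) / 2 : ℝ) : ℂ) := by simp [gaugeDiag]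
    have h2 := hδm z
    rw [h1, norm_inv, Complex.norm_real, Real.norm_of_nonneg (by linarith), inv_div]
    gcongr
  have hpic : Continuous fun z => (gaugeDiag m z)⁻¹ :=
    (continuous_gaugeDiag hm).inv₀ (gaugeDiag_ne_zero hm)
  have hmul : ∀ {f g : ℝ → ℂ} {c : ℝ}, Continuous f → (∀ z, ‖f z‖ ≤ c) → Integrable g →
      Integrable fun z => f z * g z := fun hf hc hg =>
    hg.bdd_mul hf.aestronglyMeasurable (Eventually.of_forall hc)
  have hpc := continuous_gaugeDiag hm
  have hqc := continuous_gaugeOff hm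
  refine (hmul hpic hpi ?_).neg
  have h1 : ‖(1 : ℂ)‖ ≤ 1 := by simp
  have h2 : ‖(-1 : ℂ)‖ ≤ 1 := by simp
  fin_cases i <;> fin_cases j
  · exact (hmul hpc (norm_gaugeDiag_le hm) hp).add (hmul (hqc _) (norm_gaugeOff_le hm h2) (hq _))
  · exact (hmul (hqc _) (norm_gaugeOff_le hm h2) hp).sub (hmul hpc (norm_gaugeDiag_le hm) (hq _))
  · exact (hmul hpc (norm_gaugeDiag_le hm) (hq _)).sub (hmul (hqc _) (norm_gaugeOff_le hm h1) hp)
  · exact (hmul hpc (norm_gaugeDiag_le hm) hp).add (hmul (hqc _) (norm_gaugeOff_le hm h1) (hq _))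

end Gauge

/-! ### Existence of the Jost function `ψ` -/

theorem absolutelyContinuousOnInterval_exp (c : ℂ) (a b : ℝ) :
    AbsolutelyContinuousOnInterval (fun z : ℝ => Complex.exp (c * z)) a b :=
  absolutelyContinuousOnInterval_of_hasDerivAt (g := fun z : ℝ => Complex.exp (c * z) * c)
    (by fun_prop) (fun x => by
      have := (((hasDerivAt_id x).ofReal_comp).const_mul c).cexp
      simpa using this) a b

theorem hasDerivAt_exp_mul_ofReal (c : ℂ) (z : ℝ) :
    HasDerivAt (fun z : ℝ => Complex.exp (c * z)) (Complex.exp (c * z) * c) z := by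
  have := (((hasDerivAt_id z).ofReal_comp).const_mul c).cexp
  simpa using this

/-- A solution of the Volterra equation solves the differential system almost everywhere. -/
theorem volterra_solution_properties {w : Fin 2 → Fin 2 → ℝ → ℂ} (hw : ∀ i j, Integrable (w i j))
    {H : Fin 2 → ℝ → ℂ} (hHc : ∀ i, Continuous (H i)) {C : ℝ} (hHb : ∀ i z, ‖H i z‖ ≤ C)
    {l : ℂ} (hl : l ∈ closure upperPlane)
    (hH : ∀ i z, H i z =
      ![1, 0] i - ∫ y in Ioi z, volterraKernel i l (y - z) * ∑ j, w i j y * H j y) :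
    (∀ i a b, AbsolutelyContinuousOnInterval (H i) a b) ∧
    (∀ᵐ z, HasDerivAt (H 0) (∑ j, w 0 j z * H j z) z) ∧
    (∀ᵐ z, HasDerivAt (H 1) (-(2 * Complex.I * l) * H 1 z + ∑ j, w 1 j z * H j z) z) ∧
    Tendsto (H 0) atTop (𝓝 1) ∧ Tendsto (H 1) atTop (𝓝 0) := by
  set A : Fin 2 → ℝ → ℂ := fun i y => ∑ j, w i j y * H j y with hA
  have hAi : ∀ i, Integrable (A i) := fun i => integrable_finsetSum _ fun j _ =>
    (hw i j).mul_bdd (hHc j).aestronglyMeasurable (Eventually.of_forall (hHb j))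
  have hH0 : H 0 = fun z => 1 - ∫ y in Ioi z, A 0 y := by
    ext z
    simpa [volterraKernel, hA] using hH 0 z
  have hH1' : ∀ z, H 1 z =
      -∫ y in Ioi z, Complex.exp (2 * Complex.I * l * ((y - z : ℝ) : ℂ)) * A 1 y := by
    intro z
    have := hH 1 z
    simpa only [volterraKernel, Fin.isValue, one_ne_zero, if_false, Matrix.cons_val_one,
      Matrix.cons_val_fin_one, zero_sub] using this
  have hH1 : H 1 = fun z : ℝ => Complex.exp (-(2 * Complex.I * l) * z) *
      -∫ y in Ioi z, Complex.exp (2 * Complex.I * l * y) * A 1 y := by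
    ext z
    rw [hH1' z, RegularSource.integral_exp_mul_eq, neg_mul, mul_neg]
  have hI0 : ∀ a, IntegrableOn (A 0) (Ioi a) := fun a => (hAi 0).integrableOn
  have hI1 := RegularSource.integrableOn_exp_two_I_mul hl (hAi 1)
  refine ⟨?_, ?_, ?_, ?_, ?_⟩
  · intro i a b
    fin_cases i
    · simp only [Fin.zero_eta, hH0]
      exact ((LipschitzWith.const _).lipschitzOnWith
        (s := uIcc a b)).absolutelyContinuousOnInterval.fun_sub
        (absolutelyContinuousOnInterval_integral_Ioi hI0 a b)
    · simp only [Fin.mk_one, hH1]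
      exact (absolutelyContinuousOnInterval_exp _ a b).fun_smul
        (absolutelyContinuousOnInterval_integral_Ioi hI1 a b).fun_neg
  · filter_upwards [ae_hasDerivAt_integral_Ioi hI0] with z hz
    rw [hH0]
    simpa only [neg_neg] using hz.const_sub 1
  · filter_upwards [ae_hasDerivAt_integral_Ioi hI1] with z hz
    have h1 := (hasDerivAt_exp_mul_ofReal (-(2 * Complex.I * l)) z).fun_mul hz.fun_neg
    have h2 : Complex.exp (-(2 * Complex.I * l) * z) * Complex.exp (2 * Complex.I * l * z) = 1 := by
      rw [← Complex.exp_add, neg_mul, neg_add_cancel, Complex.exp_zero]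
    have h3 := congrFun hH1 z
    rw [← hH1] at h1
    refine h1.congr_deriv ?_
    rw [h3]
    linear_combination A 1 z * h2
  · have := (tendsto_integral_Ioi_atTop (f := A 0)).const_sub 1
    rw [hH0]
    simpa using this
  · have h0 : Tendsto (fun z => ∫ y in Ioi z, ‖A 1 y‖) atTop (𝓝 0) := tendsto_integral_Ioi_atTop
    refine squeeze_zero_norm (fun z => ?_) h0
    rw [hH1' z, norm_neg]
    exact norm_integral_exp_mul_le hl (hAi 1).integrableOn

/-- The Faddeev function `e^{-ilz} ψ(z, l)`. -/
theorem exists_faddeev (hm : Admissible m) : ∃ n : ℝ → ℂ → Fin 2 → ℂ,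
    (∃ C, ∀ z, ∀ l ∈ closure upperPlane, ∀ i, ‖n z l i‖ ≤ C) ∧
    (∀ l ∈ closure upperPlane, IsPsi m l fun z => Complex.exp (Complex.I * l * z) • n z l) ∧
    (∀ z i, RegularWithLimit upperPlane fun l => n z l i) ∧
    ∀ z, ∃ c : ℂ, Tendsto (fun l => n z l 0) upperInfty (𝓝 (c * (1 + (m z 2 : ℂ)))) ∧
      Tendsto (fun l => n z l 1) upperInfty
        (𝓝 (c * ((m z 0 : ℂ) + Complex.I * (m z 1 : ℂ)))) := by
  obtain ⟨h, C, L, hL, hreg, hvol⟩ := exists_volterra_solution (integrable_gaugePotential hm)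
  have hp := continuous_gaugeDiag hm
  have hq := continuous_gaugeOff hm
  -- The vector V h, with h the Volterra solution.
  set n : ℝ → ℂ → Fin 2 → ℂ := fun z l =>
    ![gaugeDiag m z * h 0 z l - gaugeOff (-1) m z * h 1 z l,
      gaugeOff 1 m z * h 0 z l + gaugeDiag m z * h 1 z l] with hn
  -- Since the second component of h tends to 0, only the first column of V survives in the limit.
  have hlim0 : ∀ z, Tendsto (fun l => n z l 0) upperInfty (𝓝 (gaugeDiag m z * L 0 z)) := by
    intro z
    have := (((hreg 0).tendsto z).const_mul (gaugeDiag m z)).sub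
      (((hreg 1).tendsto z).const_mul (gaugeOff (-1) m z))
    simpa [hL, hn] using this
  have hlim1 : ∀ z, Tendsto (fun l => n z l 1) upperInfty (𝓝 (gaugeOff 1 m z * L 0 z)) := by
    intro z
    have := (((hreg 0).tendsto z).const_mul (gaugeOff 1 m z)).add
      (((hreg 1).tendsto z).const_mul (gaugeDiag m z))
    simpa [hL, hn] using this
  have hpb : ∀ z, ‖gaugeDiag m z‖ ≤ 1 ∧ ‖gaugeOff 1 m z‖ ≤ 1 ∧ ‖gaugeOff (-1) m z‖ ≤ 1 :=
    fun z => ⟨norm_gaugeDiag_le hm z, norm_gaugeOff_le hm (by simp) z,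
      norm_gaugeOff_le hm (by simp) z⟩
  refine ⟨n, ⟨C + C, fun z l hl i => ?_⟩, fun l hl => ?_, fun z i => ?_,
    fun z => ⟨L 0 z / 2, ?_, ?_⟩⟩
  · obtain ⟨h1, h2, h3⟩ := hpb z
    have key : ∀ x y : ℂ, ‖x‖ ≤ 1 → ‖y‖ ≤ 1 → ‖x * h 0 z l‖ + ‖y * h 1 z l‖ ≤ C + C := by
      intro x y hx hy
      rw [norm_mul, norm_mul]
      exact add_le_add
        ((mul_le_of_le_one_left (norm_nonneg _) hx).trans ((hreg 0).bound z l hl))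
        ((mul_le_of_le_one_left (norm_nonneg _) hy).trans ((hreg 1).bound z l hl))
    fin_cases i
    · exact (norm_sub_le _ _).trans (key _ _ h1 h3)
    · exact (norm_add_le _ _).trans (key _ _ h2 h1)
  · obtain ⟨hac, hd0, hd1, ht0, ht1⟩ := volterra_solution_properties
      (integrable_gaugePotential hm) (H := fun i z => h i z l) (fun i => (hreg i).continuous l hl)
      (fun i z => (hreg i).bound z l hl) hl (fun i z => hvol i z l hl)
    set f : ℝ → Fin 2 → ℂ := fun z => Complex.exp (Complex.I * l * z) • n z l with hf
    have hf0 : (fun z => f z 0) = fun z : ℝ => Complex.exp (Complex.I * l * z) *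
        (gaugeDiag m z * h 0 z l - gaugeOff (-1) m z * h 1 z l) := rfl
    have hf1 : (fun z => f z 1) = fun z : ℝ => Complex.exp (Complex.I * l * z) *
        (gaugeOff 1 m z * h 0 z l + gaugeDiag m z * h 1 z l) := rfl
    have hpac := absolutelyContinuousOnInterval_gaugeDiag hm
    have hqac := absolutelyContinuousOnInterval_gaugeOff hm
    have hf0ac : ∀ a b, AbsolutelyContinuousOnInterval (fun z => f z 0) a b := fun a b =>
      (absolutelyContinuousOnInterval_exp (Complex.I * l) a b).fun_smul
        (((hpac a b).fun_smul (hac 0 a b)).fun_sub ((hqac (-1) a b).fun_smul (hac 1 a b)))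
    have hf1ac : ∀ a b, AbsolutelyContinuousOnInterval (fun z => f z 1) a b := fun a b =>
      (absolutelyContinuousOnInterval_exp (Complex.I * l) a b).fun_smul
        (((hqac 1 a b).fun_smul (hac 0 a b)).fun_add ((hpac a b).fun_smul (hac 1 a b)))
    have hc : ∀ i, Continuous fun z => (m z i : ℂ) := fun i =>
      Complex.continuous_ofReal.comp (hm.continuous_apply i)
    have hf0c : Continuous fun z => f z 0 := by
      have := (hreg 0).continuous l hl
      have := (hreg 1).continuous l hl
      have := hq (-1)
      rw [hf0]
      fun_prop
    have hf1c : Continuous fun z => f z 1 := by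
      have := (hreg 0).continuous l hl
      have := (hreg 1).continuous l hl
      have := hq 1
      rw [hf1]
      fun_prop
    have he0 : ∀ z, f z 0 = Complex.exp (Complex.I * l * z) *
        (gaugeDiag m z * h 0 z l - gaugeOff (-1) m z * h 1 z l) := fun z => rfl
    have he1 : ∀ z, f z 1 = Complex.exp (Complex.I * l * z) *
        (gaugeOff 1 m z * h 0 z l + gaugeDiag m z * h 1 z l) := fun z => rfl
    have hm2 : ∀ z, (m z 2 : ℂ) = 2 * gaugeDiag m z - 1 := fun z => by rw [gaugeDiag]; ring
    have hmm : ∀ z, (m z 0 : ℂ) - Complex.I * (m z 1 : ℂ) = 2 * gaugeOff (-1) m z := fun z => by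
      rw [gaugeOff]; ring
    have hmp : ∀ z, (m z 0 : ℂ) + Complex.I * (m z 1 : ℂ) = 2 * gaugeOff 1 m z := fun z => by
      rw [gaugeOff]; ring
    refine ⟨isSolution_iff.2 fun z => ⟨?_, ?_⟩, ?_⟩
    -- V and h are only absolutely continuous, but the right-hand side of the equation is
    -- continuous, so differentiating almost everywhere suffices.
    · refine hasDerivAt_of_absolutelyContinuousOnInterval hf0ac (g := fun z => Complex.I * l *
        ((m z 2 : ℂ) * f z 0 + ((m z 0 : ℂ) - Complex.I * (m z 1 : ℂ)) * f z 1)) ?_ ?_ z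
      · exact continuous_const.mul (((hc 2).mul hf0c).add
          (((hc 0).sub (continuous_const.mul (hc 1))).mul hf1c))
      · filter_upwards [hd0, hd1, ae_hasDerivAt_gaugeDiag hm, ae_hasDerivAt_gaugeOff hm (-1)]
          with z h0 h1 hp' hq'
        refine ((hasDerivAt_exp_mul_ofReal (Complex.I * l) z).fun_mul
          ((hp'.fun_mul h0).fun_sub (hq'.fun_mul h1))).congr_deriv ?_
        obtain ⟨r1, r2, -, -⟩ := gauge_mul_gaugePotential hm z
        rw [he0 z, he1 z, hm2 z, hmm z, Fin.sum_univ_two, Fin.sum_univ_two]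
        -- The identities `r1`, `r2` (VW = -V') cancel the derivatives of the gauge;
        -- `gauge_relation` accounts for the terms with λ.
        linear_combination Complex.exp (Complex.I * l * z) * (h 0 z l * r1 + h 1 z l * r2 -
          2 * Complex.I * l * h 0 z l * gauge_relation hm z)
    · refine hasDerivAt_of_absolutelyContinuousOnInterval hf1ac (g := fun z => Complex.I * l *
        (((m z 0 : ℂ) + Complex.I * (m z 1 : ℂ)) * f z 0 - (m z 2 : ℂ) * f z 1)) ?_ ?_ z
      · exact continuous_const.mul ((((hc 0).add (continuous_const.mul (hc 1))).mul hf0c).sub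
          ((hc 2).mul hf1c))
      · filter_upwards [hd0, hd1, ae_hasDerivAt_gaugeDiag hm, ae_hasDerivAt_gaugeOff hm 1]
          with z h0 h1 hp' hq'
        refine ((hasDerivAt_exp_mul_ofReal (Complex.I * l) z).fun_mul
          ((hq'.fun_mul h0).fun_add (hp'.fun_mul h1))).congr_deriv ?_
        obtain ⟨-, -, r1, r2⟩ := gauge_mul_gaugePotential hm z
        rw [he0 z, he1 z, hm2 z, hmp z, Fin.sum_univ_two, Fin.sum_univ_two]
        linear_combination Complex.exp (Complex.I * l * z) * (h 0 z l * r1 + h 1 z l * r2 +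
          2 * Complex.I * l * h 1 z l * gauge_relation hm z)
    · have hcancel : (fun z : ℝ => Complex.exp (-(1 * Complex.I * l * z)) • f z) =
          fun z => n z l := by
        ext z i
        simp only [hf, smul_smul, ← Complex.exp_add, one_mul, neg_add_cancel, Complex.exp_zero,
          one_smul]
      rw [hcancel, tendsto_pi_nhds, Fin.forall_fin_two]
      have tp := tendsto_gaugeDiag_atTop hm
      have tq := tendsto_gaugeOff_atTop hm
      constructor
      · simpa [hn] using (tp.mul ht0).sub ((tq (-1)).mul ht1)
      · simpa [hn] using ((tq 1).mul ht0).add (tp.mul ht1)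
  · obtain ⟨c0, c1⟩ : ContinuousOn (h 0 z) (closure upperPlane) ∧
        ContinuousOn (h 1 z) (closure upperPlane) :=
      ⟨(hreg 0).continuousOn z, (hreg 1).continuousOn z⟩
    have d0 := (hreg 0).differentiableOn z
    have d1 := (hreg 1).differentiableOn z
    fin_cases i
    · exact regularWithLimit_upperPlane
        ((continuousOn_const.mul c0).sub (continuousOn_const.mul c1))
        ((d0.const_mul _).sub (d1.const_mul _)) (hlim0 z)
    · exact regularWithLimit_upperPlane
        ((continuousOn_const.mul c0).add (continuousOn_const.mul c1))
        ((d0.const_mul _).add (d1.const_mul _)) (hlim1 z)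
  · convert hlim0 z using 2
    rw [gaugeDiag]; ring
  · convert hlim1 z using 2
    rw [gaugeOff]; ring

/-! ### Solutions of the linear system -/

/-- The vector field is Lipschitz in the sup norm with constant 3|λ|, uniformly in z, because |m₃| ≤
1 and |m₁ ± i m₂| ≤ 2. -/
theorem Admissible.solution_unique (hm : Admissible m) {l : ℂ} {f g : ℝ → Fin 2 → ℂ}
    (hf : IsSolution m l f) (hg : IsSolution m l g) {z₀ : ℝ} (h : f z₀ = g z₀) : f = g := by
  have key : ∀ z (x : Fin 2 → ℂ) (i : Fin 2),
      ‖((Complex.I * l) • pauliDot (m z)).mulVec x i‖ ≤ 3 * ‖l‖ * ‖x‖ := by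
    intro z x i
    have hx0 := norm_le_pi_norm x 0
    have hx1 := norm_le_pi_norm x 1
    have hb : ∀ i, ‖(m z i : ℂ)‖ ≤ 1 := hm.norm_apply_le z
    have hb' : ∀ s : ℂ, ‖s‖ ≤ 1 → ‖(m z 0 : ℂ) + s * (m z 1 : ℂ)‖ ≤ 2 := by
      intro s hs
      refine (norm_add_le _ _).trans ?_
      rw [norm_mul]
      have := mul_le_one₀ hs (norm_nonneg _) (hb 1)
      linarith [hb 0]
    have hmul : ∀ {a y : ℂ} {c : ℝ}, ‖a‖ ≤ c → ‖y‖ ≤ ‖x‖ → ‖a * y‖ ≤ c * ‖x‖ := by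
      intro a y c ha hy
      rw [norm_mul]
      exact mul_le_mul ha hy (norm_nonneg _) ((norm_nonneg _).trans ha)
    have h3 : ∀ a y a' y' : ℂ, ‖a‖ ≤ 1 → ‖y‖ ≤ ‖x‖ → ‖a'‖ ≤ 2 → ‖y'‖ ≤ ‖x‖ →
        ‖Complex.I * l * (a * y + a' * y')‖ ≤ 3 * ‖l‖ * ‖x‖ := by
      intro a y a' y' ha hy ha' hy'
      rw [norm_mul, norm_mul, Complex.norm_I, one_mul]
      calc ‖l‖ * ‖a * y + a' * y'‖ ≤ ‖l‖ * (1 * ‖x‖ + 2 * ‖x‖) := by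
            gcongr
            exact (norm_add_le _ _).trans (add_le_add (hmul ha hy) (hmul ha' hy'))
        _ = 3 * ‖l‖ * ‖x‖ := by ring
    fin_cases i
    · refine le_of_eq_of_le (congrArg _ ?_) (h3 (m z 2 : ℂ) (x 0)
        ((m z 0 : ℂ) + -Complex.I * (m z 1 : ℂ)) (x 1) (hb 2) hx0 (hb' _ (by simp)) hx1)
      simp [pauliDot, σ₁, σ₂, σ₃, Matrix.mulVec, dotProduct, Fin.sum_univ_two]
      ring
    · refine le_of_eq_of_le (congrArg _ ?_) (h3 (-(m z 2 : ℂ)) (x 1)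
        ((m z 0 : ℂ) + Complex.I * (m z 1 : ℂ)) (x 0) (by rw [norm_neg]; exact hb 2) hx1
        (hb' _ (by simp)) hx0)
      simp [pauliDot, σ₁, σ₂, σ₃, Matrix.mulVec, dotProduct, Fin.sum_univ_two]
      ring
  refine ODE_solution_unique_univ (v := fun z x => ((Complex.I * l) • pauliDot (m z)).mulVec x)
    (s := fun _ => univ) (K := 3 * ‖l‖₊) (t₀ := z₀) (fun z => ?_)
    (fun z => ⟨hf z, mem_univ _⟩) (fun z => ⟨hg z, mem_univ _⟩) h
  refine (LipschitzWith.of_dist_le_mul fun x y => ?_).lipschitzOnWith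
  rw [dist_eq_norm, dist_eq_norm, ← Matrix.mulVec_sub, NNReal.coe_mul, NNReal.coe_ofNat,
    coe_nnnorm, pi_norm_le_iff_of_nonneg (by positivity)]
  exact key z (x - y)

/-! ### Wronskians and uniqueness of normalized solutions -/

theorem IsSolution.smul_add_smul {l : ℂ} {f g : ℝ → Fin 2 → ℂ} (hf : IsSolution m l f)
    (hg : IsSolution m l g) (c d : ℂ) : IsSolution m l fun z => c • f z + d • g z := by
  intro z
  refine (((hf z).const_smul c).add ((hg z).const_smul d)).congr_deriv ?_
  rw [Matrix.mulVec_add, Matrix.mulVec_smul, Matrix.mulVec_smul]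

/-- The Wronskian of two vector functions. -/
def wronskian (f g : ℝ → Fin 2 → ℂ) (z : ℝ) : ℂ := f z 0 * g z 1 - f z 1 * g z 0

/-- The coefficient matrix m·σ is traceless. -/
theorem IsSolution.wronskian_eq {l : ℂ} {f g : ℝ → Fin 2 → ℂ} (hf : IsSolution m l f)
    (hg : IsSolution m l g) (z w : ℝ) : wronskian f g z = wronskian f g w := by
  have hd : ∀ z, HasDerivAt (wronskian f g) 0 z := by
    intro z
    obtain ⟨f0, f1⟩ := isSolution_iff.1 hf z
    obtain ⟨g0, g1⟩ := isSolution_iff.1 hg z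
    refine ((f0.fun_mul g1).fun_sub (f1.fun_mul g0)).congr_deriv ?_
    ring
  exact is_const_of_deriv_eq_zero (fun z => (hd z).differentiableAt) (fun z => (hd z).deriv) z w

theorem tendsto_apply_of_isJost {s : ℂ} {F : Filter ℝ} {v : Fin 2 → ℂ} {l : ℂ}
    {f : ℝ → Fin 2 → ℂ} (hf : IsJost m s F v l f) (i : Fin 2) :
    Tendsto (fun z : ℝ => Complex.exp (-(s * Complex.I * l * z)) * f z i) F (𝓝 (v i)) := by
  simpa using (tendsto_pi_nhds.1 hf.2) i

/-- The constant Wronskian equals the bounded factor e^{2siλz} times the Wronskian of the normalized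
functions, which tends to 0 because both have limit `v`. So the two solutions are proportional, and
the common limit `v ≠ 0` makes the factor 1. -/
theorem IsJost.unique (hm : Admissible m) {s : ℂ} {F : Filter ℝ} [F.NeBot] {v : Fin 2 → ℂ}
    (hv : v ≠ 0) {l : ℂ} (hF : ∀ᶠ z : ℝ in F, ‖Complex.exp (s * Complex.I * l * z)‖ ≤ 1)
    {f g : ℝ → Fin 2 → ℂ} (hf : IsJost m s F v l f) (hg : IsJost m s F v l g) : f = g := by
  have hfs : IsSolution m l f := hf.1
  have hgs : IsSolution m l g := hg.1
  have ef := tendsto_apply_of_isJost hf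
  have eg := tendsto_apply_of_isJost hg
  have hee : ∀ z : ℝ, Complex.exp (s * Complex.I * l * z) *
      Complex.exp (-(s * Complex.I * l * z)) = 1 := fun z => by
    rw [← Complex.exp_add, add_neg_cancel, Complex.exp_zero]
  have hw : ∀ z, wronskian f g z = 0 := by
    intro z
    have h1 := ((ef 0).mul (eg 1)).sub ((ef 1).mul (eg 0))
    rw [mul_comm (v 1), sub_self] at h1
    have h2 : Tendsto (fun _ : ℝ => wronskian f g z) F (𝓝 0) := by
      refine squeeze_zero_norm' ?_ (by simpa using h1.norm)
      filter_upwards [hF] with w hw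
      have h3 : wronskian f g z = Complex.exp (s * Complex.I * l * w) *
          Complex.exp (s * Complex.I * l * w) *
          (Complex.exp (-(s * Complex.I * l * w)) * f w 0 *
            (Complex.exp (-(s * Complex.I * l * w)) * g w 1) -
          Complex.exp (-(s * Complex.I * l * w)) * f w 1 *
            (Complex.exp (-(s * Complex.I * l * w)) * g w 0)) := by
        rw [hfs.wronskian_eq hgs z w, wronskian]
        linear_combination -(f w 0 * g w 1 - f w 1 * g w 0) *
          (Complex.exp (s * Complex.I * l * w) * Complex.exp (-(s * Complex.I * l * w)) + 1) * hee w
      rw [h3, norm_mul, norm_mul]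
      exact mul_le_of_le_one_left (norm_nonneg _) (mul_le_one₀ hw (norm_nonneg _) hw)
    exact tendsto_nhds_unique tendsto_const_nhds h2
  obtain ⟨z, hz⟩ : ∃ z, g z ≠ 0 := by
    obtain ⟨z, hz⟩ := (hg.2.eventually_ne hv).exists
    exact ⟨z, fun h => hz (by simp [h])⟩
  obtain ⟨c, hc⟩ : ∃ c : ℂ, f z = c • g z := by
    have hwz := hw z
    rw [wronskian] at hwz
    by_cases h0 : g z 0 = 0
    · have h1 : g z 1 ≠ 0 := fun h1 => hz (by ext i; fin_cases i <;> simp [h0, h1])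
      refine ⟨f z 1 / g z 1, ?_⟩
      have hf0 : f z 0 = 0 := by
        rw [h0, mul_zero, sub_zero] at hwz
        exact (mul_eq_zero.1 hwz).resolve_right h1
      ext i
      fin_cases i
      · simp [h0, hf0]
      · simp [h1]
    · refine ⟨f z 0 / g z 0, ?_⟩
      ext i
      fin_cases i
      · simp [h0]
      · simp only [Fin.mk_one, Pi.smul_apply, smul_eq_mul]
        field_simp
        linear_combination -hwz
  have hfg : f = fun z => c • g z := by
    have h := hgs.smul_add_smul hgs c 0
    simp only [zero_smul, add_zero] at h
    exact hm.solution_unique hfs h hc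
  have hlim : c • v = v := by
    refine tendsto_nhds_unique (hg.2.const_smul c) (hf.2.congr fun w => ?_)
    rw [hfg, smul_comm]
  obtain ⟨i, hi⟩ := Function.ne_iff.1 hv
  have hc1 : c = 1 := by
    have := congrFun hlim i
    simp only [Pi.smul_apply, smul_eq_mul] at this
    exact (mul_eq_right₀ hi).1 this
  rw [hfg, hc1]
  simp

/-! ### Symmetries -/

/-- The antiunitary symmetry of the spin system. -/
def conjFlip (v : Fin 2 → ℂ) : Fin 2 → ℂ := ![-star (v 1), star (v 0)]

/-- Complex conjugation followed by conjugation with σ₂ sends m·σ to -m·σ, and conjugating iλ̄ gives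
-iλ, so the two signs cancel in the equation. The exponential normalization changes its sign. -/
theorem IsJost.conjFlip {s : ℂ} (hs : star s = s) {F : Filter ℝ} {v : Fin 2 → ℂ} {l : ℂ}
    {f : ℝ → Fin 2 → ℂ} (hf : IsJost m s F v (star l) f) :
    IsJost m (-s) F (conjFlip v) l fun z => conjFlip (f z) := by
  refine ⟨isSolution_iff.2 fun z => ?_, ?_⟩
  · obtain ⟨f0, f1⟩ := isSolution_iff.1 hf.1 z
    constructor
    · refine (f1.star.neg).congr_deriv ?_
      simp [Heisenberg.conjFlip]
      left
      ring
    · refine f0.star.congr_deriv ?_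
      simp [Heisenberg.conjFlip]
      ring
  · have e := tendsto_apply_of_isJost hf
    have hs' : (starRingEnd ℂ) s = s := hs
    have hexp : ∀ z : ℝ, star (Complex.exp (-(s * Complex.I * star l * z))) =
        Complex.exp (-(-s * Complex.I * l * z)) := by
      intro z
      rw [Complex.star_def, ← Complex.exp_conj]
      congr 1
      simp [hs']
    rw [tendsto_pi_nhds, Fin.forall_fin_two]
    constructor
    · refine ((e 1).star.neg).congr fun z => ?_
      rw [star_mul', hexp]
      simp [Heisenberg.conjFlip]
    · refine (e 0).star.congr fun z => ?_
      rw [star_mul', hexp]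
      simp [Heisenberg.conjFlip]

/-- The sign from the chain rule is absorbed by λ ↦ -λ, which also leaves the exponent λz unchanged.
-/
theorem IsJost.comp_neg {s : ℂ} {v : Fin 2 → ℂ} {l : ℂ} {f : ℝ → Fin 2 → ℂ}
    (hf : IsJost (fun z => m (-z)) s atTop v (-l) f) :
    IsJost m s atBot v l fun z => f (-z) := by
  refine ⟨fun z => ?_, ?_⟩
  · have := (hf.1 (-z)).scomp z (hasDerivAt_neg z)
    refine this.congr_deriv ?_
    simp only [neg_neg, mul_neg, neg_smul, one_smul, Matrix.neg_mulVec]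
  · have := hf.2.comp tendsto_neg_atBot_atTop
    refine this.congr fun z => ?_
    simp

theorem RegularWithLimit.comp_neg {f : ℂ → ℂ} (hf : RegularWithLimit upperPlane f) :
    RegularWithLimit lowerPlane fun l => f (-l) := by
  obtain ⟨ha, hc, L, hL⟩ := hf
  have hmaps : MapsTo (fun l : ℂ => -l) (closure lowerPlane) (closure upperPlane) := by
    intro l hl
    rw [closure_lowerPlane] at hl
    rw [closure_upperPlane]
    simpa using hl
  refine ⟨?_, hc.comp continuous_neg.continuousOn hmaps, L, hL.comp ?_⟩
  · refine DifferentiableOn.analyticOnNhd ?_ isOpen_lowerPlane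
    refine ha.differentiableOn.comp differentiable_neg.differentiableOn fun l hl => ?_
    simpa [upperPlane, lowerPlane] using hl
  · exact tendsto_neg_cobounded.inf (tendsto_principal_principal.2 hmaps)

theorem RegularWithLimit.star_star {f : ℂ → ℂ} {U V : Set ℂ} (hf : RegularWithLimit U f)
    (hV : IsOpen V) (hUV : MapsTo (fun l : ℂ => star l) V U)
    (hUV' : MapsTo (fun l : ℂ => star l) (closure V) (closure U)) :
    RegularWithLimit V fun l => star (f (star l)) := by
  obtain ⟨ha, hc, L, hL⟩ := hf
  refine ⟨?_, (hc.comp continuous_star.continuousOn hUV').star, star L, (hL.comp ?_).star⟩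
  · refine DifferentiableOn.analyticOnNhd (fun l hl => ?_) hV
    have h1 : DifferentiableAt ℂ f (star l) := (ha _ (hUV hl)).differentiableAt
    have := h1.star_star
    rw [_root_.star_star] at this
    exact this.differentiableWithinAt
  · refine Tendsto.inf ?_ (tendsto_principal_principal.2 hUV')
    rw [← tendsto_norm_atTop_iff_cobounded]
    simpa using tendsto_norm_cobounded_atTop (E := ℂ)

theorem RegularWithLimit.neg {U : Set ℂ} {f : ℂ → ℂ} (hf : RegularWithLimit U f) :
    RegularWithLimit U fun l => -f l := by
  simpa using (RegularWithLimit.const (U := U) (-1)).mul hf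

theorem star_mem_closure_upperPlane {l : ℂ} (hl : l ∈ closure lowerPlane) :
    star l ∈ closure upperPlane := by
  rw [closure_lowerPlane] at hl
  rw [closure_upperPlane]
  simpa using hl

theorem star_mem_closure_lowerPlane {l : ℂ} (hl : l ∈ closure upperPlane) :
    star l ∈ closure lowerPlane := by
  rw [closure_upperPlane] at hl
  rw [closure_lowerPlane]
  simpa using hl

theorem neg_mem_closure_upperPlane {l : ℂ} (hl : l ∈ closure lowerPlane) :
    -l ∈ closure upperPlane := by
  rw [closure_lowerPlane] at hl
  rw [closure_upperPlane]
  simpa using hl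

theorem RegularWithLimit.star_star_lower {f : ℂ → ℂ} (hf : RegularWithLimit upperPlane f) :
    RegularWithLimit lowerPlane fun l => star (f (star l)) :=
  hf.star_star isOpen_lowerPlane
    (fun l hl => by simpa [upperPlane, lowerPlane] using hl) fun _ => star_mem_closure_upperPlane

theorem RegularWithLimit.star_star_upper {f : ℂ → ℂ} (hf : RegularWithLimit lowerPlane f) :
    RegularWithLimit upperPlane fun l => star (f (star l)) :=
  hf.star_star isOpen_upperPlane
    (fun l hl => by simpa [upperPlane, lowerPlane] using hl) fun _ => star_mem_closure_lowerPlane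

/-! ### The four Jost functions -/

theorem conjFlip_one_zero : conjFlip ![1, 0] = ![0, 1] := by simp [conjFlip]

theorem norm_exp_le_one_of_re_nonpos {c : ℂ} (h : c.re ≤ 0) : ‖Complex.exp c‖ ≤ 1 := by
  rw [Complex.norm_exp]
  exact Real.exp_le_one_iff.2 h

theorem vec_one_zero_ne_zero : (![1, 0] : Fin 2 → ℂ) ≠ 0 := fun h => by simpa using congrFun h 0

theorem vec_zero_one_ne_zero : (![0, 1] : Fin 2 → ℂ) ≠ 0 := fun h => by simpa using congrFun h 1

section Jost

variable (hm : Admissible m) {l : ℂ} {f g : ℝ → Fin 2 → ℂ}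
include hm

theorem IsPsi.unique (hl : l ∈ closure upperPlane) (hf : IsPsi m l f) (hg : IsPsi m l g) :
    f = g := by
  rw [closure_upperPlane] at hl
  refine IsJost.unique hm vec_one_zero_ne_zero ?_ hf hg
  filter_upwards [eventually_ge_atTop 0] with z hz
  exact norm_exp_le_one_of_re_nonpos (by simpa using mul_nonneg hl hz)

theorem IsPsiBar.unique (hl : l ∈ closure lowerPlane) (hf : IsPsiBar m l f)
    (hg : IsPsiBar m l g) : f = g := by
  rw [closure_lowerPlane] at hl
  refine IsJost.unique hm vec_zero_one_ne_zero ?_ hf hg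
  filter_upwards [eventually_ge_atTop 0] with z hz
  exact norm_exp_le_one_of_re_nonpos (by simpa using mul_nonpos_of_nonpos_of_nonneg hl hz)

theorem IsPhiBar.unique (hl : l ∈ closure lowerPlane) (hf : IsPhiBar m l f)
    (hg : IsPhiBar m l g) : f = g := by
  rw [closure_lowerPlane] at hl
  refine IsJost.unique hm vec_one_zero_ne_zero ?_ hf hg
  filter_upwards [eventually_le_atBot 0] with z hz
  exact norm_exp_le_one_of_re_nonpos (by simpa using mul_nonneg_of_nonpos_of_nonpos hl hz)

theorem IsPhi.unique (hl : l ∈ closure upperPlane) (hf : IsPhi m l f) (hg : IsPhi m l g) :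
    f = g := by
  rw [closure_upperPlane] at hl
  refine IsJost.unique hm vec_zero_one_ne_zero ?_ hf hg
  filter_upwards [eventually_le_atBot 0] with z hz
  exact norm_exp_le_one_of_re_nonpos (by simpa using mul_nonpos_of_nonneg_of_nonpos hl hz)

/-- By uniqueness the choice made in the definition is immaterial: any solution with the right
asymptotics may be substituted. -/
theorem psi_eq (hl : l ∈ closure upperPlane) (hf : IsPsi m l f) (z : ℝ) : psi m z l = f z :=
  congrFun (IsPsi.unique hm hl (Classical.epsilon_spec ⟨f, hf⟩) hf) z

theorem psiBar_eq (hl : l ∈ closure lowerPlane) (hf : IsPsiBar m l f) (z : ℝ) :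
    psiBar m z l = f z :=
  congrFun (IsPsiBar.unique hm hl (Classical.epsilon_spec ⟨f, hf⟩) hf) z

theorem phiBar_eq (hl : l ∈ closure lowerPlane) (hf : IsPhiBar m l f) (z : ℝ) :
    phiBar m z l = f z :=
  congrFun (IsPhiBar.unique hm hl (Classical.epsilon_spec ⟨f, hf⟩) hf) z

theorem phi_eq (hl : l ∈ closure upperPlane) (hf : IsPhi m l f) (z : ℝ) : phi m z l = f z :=
  congrFun (IsPhi.unique hm hl (Classical.epsilon_spec ⟨f, hf⟩) hf) z

theorem isPsi_psi (hl : l ∈ closure upperPlane) : IsPsi m l fun z => psi m z l := by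
  obtain ⟨n, -, hn, -⟩ := exists_faddeev hm
  exact Classical.epsilon_spec (p := IsPsi m l) ⟨_, hn l hl⟩

theorem isPsiBar_conjFlip_psi (hl : l ∈ closure lowerPlane) :
    IsPsiBar m l fun z => conjFlip (psi m z (star l)) := by
  have := IsJost.conjFlip (by simp) (isPsi_psi hm (star_mem_closure_upperPlane hl))
  rwa [conjFlip_one_zero] at this

theorem isPhiBar_psi_comp_neg (hl : l ∈ closure lowerPlane) :
    IsPhiBar m l fun z => psi (fun z => m (-z)) (-z) (-l) :=
  IsJost.comp_neg (isPsi_psi hm.comp_neg (neg_mem_closure_upperPlane hl))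

theorem psiBar_eq_conjFlip (hl : l ∈ closure lowerPlane) (z : ℝ) :
    psiBar m z l = conjFlip (psi m z (star l)) :=
  psiBar_eq hm hl (isPsiBar_conjFlip_psi hm hl) z

theorem phiBar_eq_psi (hl : l ∈ closure lowerPlane) (z : ℝ) :
    phiBar m z l = psi (fun z => m (-z)) (-z) (-l) :=
  phiBar_eq hm hl (isPhiBar_psi_comp_neg hm hl) z

theorem isPsiBar_psiBar (hl : l ∈ closure lowerPlane) : IsPsiBar m l fun z => psiBar m z l :=
  Classical.epsilon_spec (p := IsPsiBar m l) ⟨_, isPsiBar_conjFlip_psi hm hl⟩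

theorem isPhiBar_phiBar (hl : l ∈ closure lowerPlane) : IsPhiBar m l fun z => phiBar m z l :=
  Classical.epsilon_spec (p := IsPhiBar m l) ⟨_, isPhiBar_psi_comp_neg hm hl⟩

theorem isPhi_conjFlip_phiBar (hl : l ∈ closure upperPlane) :
    IsPhi m l fun z => conjFlip (phiBar m z (star l)) := by
  have := IsJost.conjFlip (by simp) (isPhiBar_phiBar hm (star_mem_closure_lowerPlane hl))
  rwa [conjFlip_one_zero] at this

theorem phi_eq_conjFlip (hl : l ∈ closure upperPlane) (z : ℝ) :
    phi m z l = conjFlip (phiBar m z (star l)) :=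
  phi_eq hm hl (isPhi_conjFlip_phiBar hm hl) z

theorem isPhi_phi (hl : l ∈ closure upperPlane) : IsPhi m l fun z => phi m z l :=
  Classical.epsilon_spec (p := IsPhi m l) ⟨_, isPhi_conjFlip_phiBar hm hl⟩

/-! ### Regularity of the Faddeev functions -/

theorem faddeev_psi : ∃ n : ℝ → ℂ → Fin 2 → ℂ,
    (∃ C, ∀ z, ∀ l ∈ closure upperPlane, ∀ i, ‖n z l i‖ ≤ C) ∧
    (∀ z : ℝ, ∀ l ∈ closure upperPlane, ∀ i,
      Complex.exp (-(Complex.I * l * z)) * psi m z l i = n z l i) ∧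
    (∀ z i, RegularWithLimit upperPlane fun l => n z l i) ∧
    ∀ z, ∃ c : ℂ, Tendsto (fun l => n z l 0) upperInfty (𝓝 (c * (1 + (m z 2 : ℂ)))) ∧
      Tendsto (fun l => n z l 1) upperInfty
        (𝓝 (c * ((m z 0 : ℂ) + Complex.I * (m z 1 : ℂ)))) := by
  obtain ⟨n, hb, hn, hreg, hlim⟩ := exists_faddeev hm
  refine ⟨n, hb, fun z l hl i => ?_, hreg, hlim⟩
  rw [psi_eq hm hl (hn l hl) z, Pi.smul_apply, smul_eq_mul, ← mul_assoc, ← Complex.exp_add,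
    neg_add_cancel, Complex.exp_zero, one_mul]

theorem regularWithLimit_psi (z : ℝ) (i : Fin 2) : RegularWithLimit upperPlane fun l =>
    Complex.exp (-(Complex.I * l * z)) * psi m z l i := by
  obtain ⟨n, -, hn, hreg, -⟩ := faddeev_psi hm
  exact (hreg z i).congr isOpen_upperPlane fun l hl => (hn z l hl i).symm

theorem regularWithLimit_psiBar (z : ℝ) (i : Fin 2) : RegularWithLimit lowerPlane fun l =>
    Complex.exp (Complex.I * l * z) * psiBar m z l i := by
  have hexp : ∀ l : ℂ, star (Complex.exp (-(Complex.I * star l * z))) =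
      Complex.exp (Complex.I * l * z) := by
    intro l
    rw [Complex.star_def, ← Complex.exp_conj]
    congr 1
    simp
  have h := fun i => (regularWithLimit_psi hm z i).star_star_lower
  fin_cases i
  · refine (h 1).neg.congr isOpen_lowerPlane fun l hl => ?_
    simp only [psiBar_eq_conjFlip hm hl, star_mul', hexp]
    simp [conjFlip]
  · refine (h 0).congr isOpen_lowerPlane fun l hl => ?_
    simp only [psiBar_eq_conjFlip hm hl, star_mul', hexp]
    simp [conjFlip]

theorem regularWithLimit_phiBar (z : ℝ) (i : Fin 2) : RegularWithLimit lowerPlane fun l =>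
    Complex.exp (-(Complex.I * l * z)) * phiBar m z l i := by
  refine (regularWithLimit_psi hm.comp_neg (-z) i).comp_neg.congr isOpen_lowerPlane
    fun l hl => ?_
  simp [phiBar_eq_psi hm hl]

theorem regularWithLimit_phi (z : ℝ) (i : Fin 2) : RegularWithLimit upperPlane fun l =>
    Complex.exp (Complex.I * l * z) * phi m z l i := by
  have hexp : ∀ l : ℂ, star (Complex.exp (-(Complex.I * star l * z))) =
      Complex.exp (Complex.I * l * z) := by
    intro l
    rw [Complex.star_def, ← Complex.exp_conj]
    congr 1
    simp
  have h := fun i => (regularWithLimit_phiBar hm z i).star_star_upper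
  fin_cases i
  · refine (h 1).neg.congr isOpen_upperPlane fun l hl => ?_
    simp only [phi_eq_conjFlip hm hl, star_mul', hexp]
    simp [conjFlip]
  · refine (h 0).congr isOpen_upperPlane fun l hl => ?_
    simp only [phi_eq_conjFlip hm hl, star_mul', hexp]
    simp [conjFlip]

end Jost

/-! ### The scattering coefficients -/

section Scattering

variable (hm : Admissible m)
include hm

theorem isSolution_psi {l : ℂ} (hl : l ∈ closure upperPlane) :
    IsSolution m l fun z => psi m z l := (isPsi_psi hm hl).1

theorem isSolution_phi {l : ℂ} (hl : l ∈ closure upperPlane) :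
    IsSolution m l fun z => phi m z l := (isPhi_phi hm hl).1

theorem isSolution_phiBar {l : ℂ} (hl : l ∈ closure lowerPlane) :
    IsSolution m l fun z => phiBar m z l := (isPhiBar_phiBar hm hl).1

/-- The derivative is iλ times the integrand in the definition of `a`, which makes `a` the limit of
this function at -∞. -/
theorem hasDerivAt_faddeev_zero {l : ℂ} (hl : l ∈ closure upperPlane) (z : ℝ) :
    HasDerivAt (fun z : ℝ => Complex.exp (-(Complex.I * l * z)) * psi m z l 0)
      (Complex.I * l * (((m z 2 : ℂ) - 1) * (Complex.exp (-(Complex.I * l * z)) * psi m z l 0) +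
      ((m z 0 : ℂ) - Complex.I * (m z 1 : ℂ)) *
        (Complex.exp (-(Complex.I * l * z)) * psi m z l 1))) z := by
  have h1 := hasDerivAt_exp_mul_ofReal (-(Complex.I * l)) z
  simp only [neg_mul] at h1
  refine (h1.fun_mul (isSolution_iff.1 (isSolution_psi hm hl) z).1).congr_deriv ?_
  ring

theorem integrable_sub_one : Integrable fun z => ((m z 2 : ℂ) - 1) := by
  have := (hm.integrable_sub 2).ofReal (𝕜 := ℂ)
  simpa [e₃] using this

theorem integrable_coord_zero : Integrable fun z => (m z 0 : ℂ) := by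
  have := (hm.integrable_sub 0).ofReal (𝕜 := ℂ)
  simpa [e₃] using this

theorem integrable_coord_one : Integrable fun z => (m z 1 : ℂ) := by
  have := (hm.integrable_sub 1).ofReal (𝕜 := ℂ)
  simpa [e₃] using this

theorem exists_bound_faddeev : ∃ C, ∀ z : ℝ, ∀ l ∈ closure upperPlane, ∀ i,
    ‖Complex.exp (-(Complex.I * l * z)) * psi m z l i‖ ≤ C := by
  obtain ⟨n, ⟨C, hC⟩, hn, -⟩ := faddeev_psi hm
  exact ⟨C, fun z l hl i => by rw [hn z l hl i]; exact hC z l hl i⟩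

theorem continuous_faddeev {l : ℂ} (hl : l ∈ closure upperPlane) (i : Fin 2) :
    Continuous fun z : ℝ => Complex.exp (-(Complex.I * l * z)) * psi m z l i := by
  have h1 : Continuous fun z => psi m z l i := by
    have := isSolution_iff.1 (isSolution_psi hm hl)
    refine continuous_iff_continuousAt.2 fun z => ?_
    fin_cases i
    · exact (this z).1.continuousAt
    · exact (this z).2.continuousAt
  exact (by fun_prop : Continuous fun z : ℝ => Complex.exp (-(Complex.I * l * z))).mul h1

theorem integrable_mul_faddeev {l : ℂ} (hl : l ∈ closure upperPlane) (i : Fin 2) {w : ℝ → ℂ}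
    (hw : Integrable w) :
    Integrable fun z : ℝ => w z * (Complex.exp (-(Complex.I * l * z)) * psi m z l i) := by
  obtain ⟨C, hC⟩ := exists_bound_faddeev hm
  exact hw.mul_bdd (continuous_faddeev hm hl i).aestronglyMeasurable
    (Eventually.of_forall fun z => hC z l hl i)

/-- In the constant Wronskian of ψ and φ the exponentials cancel. The lower Faddeev component of ψ
is bounded and meets the upper one of φ, which tends to 0; the upper one of ψ is multiplied by the
lower one of φ, which tends to 1. -/
theorem tendsto_faddeev_zero_atBot {l : ℂ} (hl : l ∈ closure upperPlane) :
    Tendsto (fun z : ℝ => Complex.exp (-(Complex.I * l * z)) * psi m z l 0) atBot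
      (𝓝 (wronskian (fun z => psi m z l) (fun z => phi m z l) 0)) := by
  set D := wronskian (fun z => psi m z l) (fun z => phi m z l) 0 with hD
  obtain ⟨C, hC⟩ := exists_bound_faddeev hm
  have hphi := tendsto_apply_of_isJost (isPhi_phi hm hl)
  have h0 : Tendsto (fun z : ℝ => Complex.exp (Complex.I * l * z) * phi m z l 0) atBot (𝓝 0) := by
    simpa using hphi 0
  have h1 : Tendsto (fun z : ℝ => Complex.exp (Complex.I * l * z) * phi m z l 1) atBot (𝓝 1) := by
    simpa using hphi 1
  have hprod : Tendsto (fun z : ℝ => (Complex.exp (-(Complex.I * l * z)) * psi m z l 1) *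
      (Complex.exp (Complex.I * l * z) * phi m z l 0)) atBot (𝓝 0) := by
    have := h0.norm.const_mul C
    rw [norm_zero, mul_zero] at this
    refine squeeze_zero_norm (fun z => ?_) this
    rw [norm_mul]
    exact mul_le_mul_of_nonneg_right (hC z l hl 1) (norm_nonneg _)
  have hquot := (hprod.const_add D).div h1 one_ne_zero
  rw [add_zero, div_one] at hquot
  refine hquot.congr' ?_
  filter_upwards [h1.eventually_ne one_ne_zero] with z hz
  have hw := (isSolution_psi hm hl).wronskian_eq (isSolution_phi hm hl) z 0
  rw [← hD, wronskian] at hw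
  simp only [Pi.div_apply]
  rw [div_eq_iff hz, ← hw]
  have hee : Complex.exp (-(Complex.I * l * z)) * Complex.exp (Complex.I * l * z) = 1 := by
    rw [← Complex.exp_add, neg_add_cancel, Complex.exp_zero]
  linear_combination (psi m z l 1 * phi m z l 0 - psi m z l 0 * phi m z l 1) * hee

theorem a_eq_wronskian {l : ℂ} (hl : l ∈ closure upperPlane) :
    a m l = wronskian (fun z => psi m z l) (fun z => phi m z l) 0 := by
  have htop : Tendsto (fun z : ℝ => Complex.exp (-(Complex.I * l * z)) * psi m z l 0) atTop
      (𝓝 1) := by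
    simpa using tendsto_apply_of_isJost (isPsi_psi hm hl) 0
  have hint := ((integrable_mul_faddeev hm hl 0 (integrable_sub_one hm)).add
    (integrable_mul_faddeev hm hl 1 ((integrable_coord_zero hm).sub
      ((integrable_coord_one hm).const_mul Complex.I)))).const_mul (Complex.I * l)
  have := integral_of_hasDerivAt_of_tendsto (hasDerivAt_faddeev_zero hm hl) hint
    (tendsto_faddeev_zero_atBot hm hl) htop
  rw [integral_const_mul] at this
  rw [a, this]
  ring

theorem regularWithLimit_a : RegularWithLimit upperPlane (a m) := by
  have h1 := fun i => regularWithLimit_psi hm 0 i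
  have h2 := fun i => regularWithLimit_phi hm 0 i
  refine (((h1 0).mul (h2 1)).add ((h1 1).mul (h2 0)).neg).congr isOpen_upperPlane
    fun l hl => ?_
  simp only [a_eq_wronskian hm hl, wronskian]
  simp
  ring

/-! ### The transition matrix on the real line -/

theorem phi_ofReal (x z : ℝ) : phi m z x = conjFlip (phiBar m z x) := by
  have := phi_eq_conjFlip hm (ofReal_mem_closure_upperPlane x) z
  rwa [Complex.star_def, Complex.conj_ofReal] at this

theorem psiBar_ofReal (x z : ℝ) : psiBar m z x = conjFlip (psi m z x) := by
  have := psiBar_eq_conjFlip hm (ofReal_mem_closure_lowerPlane x) z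
  rwa [Complex.star_def, Complex.conj_ofReal] at this

theorem wronskian_phiBar_phi (x : ℝ) :
    wronskian (fun z => phiBar m z x) (fun z => phi m z x) 0 = 1 := by
  have hu := tendsto_apply_of_isJost (isPhiBar_phiBar hm (ofReal_mem_closure_lowerPlane x))
  have hv := tendsto_apply_of_isJost (isPhi_phi hm (ofReal_mem_closure_upperPlane x))
  have hlim := ((hu 0).mul (hv 1)).sub ((hu 1).mul (hv 0))
  have h1 : Tendsto (fun _ : ℝ => wronskian (fun z => phiBar m z x) (fun z => phi m z x) 0) atBot
      (𝓝 1) := by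
    have h10 : ((![1, 0] : Fin 2 → ℂ) 0 * (![0, 1] : Fin 2 → ℂ) 1 -
      (![1, 0] : Fin 2 → ℂ) 1 * (![0, 1] : Fin 2 → ℂ) 0) = 1 := by simp
    rw [h10] at hlim
    refine hlim.congr fun z => ?_
    rw [(isSolution_phiBar hm (ofReal_mem_closure_lowerPlane x)).wronskian_eq
      (isSolution_phi hm (ofReal_mem_closure_upperPlane x)) 0 z, wronskian]
    have hee : Complex.exp (-(1 * Complex.I * x * z)) *
        Complex.exp (-(-1 * Complex.I * x * z)) = 1 := by
      rw [← Complex.exp_add]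
      convert Complex.exp_zero using 2
      ring
    linear_combination (phiBar m z x 0 * phi m z x 1 - phiBar m z x 1 * phi m z x 0) * hee
  exact tendsto_nhds_unique tendsto_const_nhds h1

/-- As the determinant of Φ is 1, Cramer's rule applies; the right-hand side is the conjugate of the
Wronskian of φ̄ and ψ. -/
theorem b_eq (x : ℝ) : b m x = star (phiBar m 0 x 0) * star (psi m 0 x 1) -
    star (phiBar m 0 x 1) * star (psi m 0 x 0) := by
  have hdet : (Phi m 0 x).det = 1 := by
    rw [Phi, Matrix.det_fin_two_of, ← wronskian_phiBar_phi hm x, wronskian]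
    ring
  rw [b, transition, Matrix.inv_def, hdet, Ring.inverse_one, one_smul, Phi, Psi,
    Matrix.adjugate_fin_two_of, phi_ofReal hm, psiBar_ofReal hm]
  simp [Matrix.mul_apply, Fin.sum_univ_two, conjFlip]
  ring

/-- At z = 0 this is the expansion in a basis of Wronskian 1; two solutions that agree at one point
agree everywhere. Applying `conjFlip` gives the second column of the transition matrix. -/
theorem psi_eq_add (x z : ℝ) :
    psi m z x = a m x • phiBar m z x + star (b m x) • phi m z x := by
  have hS := isSolution_phiBar hm (ofReal_mem_closure_lowerPlane x)
  have hS' := isSolution_phi hm (ofReal_mem_closure_upperPlane x)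
  have hW := wronskian_phiBar_phi hm x
  refine congrFun (hm.solution_unique (isSolution_psi hm (ofReal_mem_closure_upperPlane x))
    (hS.smul_add_smul hS' _ _) (z₀ := 0) ?_) z
  rw [a_eq_wronskian hm (ofReal_mem_closure_upperPlane x), b_eq hm]
  simp only [wronskian, phi_ofReal hm x] at hW ⊢
  ext i
  fin_cases i
  · simp [conjFlip] at hW ⊢
    linear_combination -psi m 0 x 0 * hW
  · simp [conjFlip] at hW ⊢
    linear_combination -psi m 0 x 1 * hW

theorem Psi_eq (x z : ℝ) : Psi m z x = Phi m z x *
    !![a m x, -b m x; star (b m x), star (a m x)] := by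
  have h := psi_eq_add hm x z
  have h0 := congrFun h 0
  have h1 := congrFun h 1
  rw [phi_ofReal hm x z] at h0 h1
  rw [Psi, Phi, psiBar_ofReal hm, phi_ofReal hm]
  simp [conjFlip] at h0 h1
  ext i j
  fin_cases i <;> fin_cases j <;> simp [Matrix.mul_apply, Fin.sum_univ_two, conjFlip, h0, h1] <;>
    ring

theorem tendsto_b {F : Filter ℝ} (hF : F ≤ Bornology.cobounded ℝ) :
    Tendsto (b m) F (𝓝 0) := by
  obtain ⟨n, -, hn, -, hlim⟩ := faddeev_psi hm
  obtain ⟨n', -, hn', -, hlim'⟩ := faddeev_psi hm.comp_neg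
  obtain ⟨c, h0, h1⟩ := hlim 0
  obtain ⟨c', h0', h1'⟩ := hlim' 0
  have t1 : Tendsto (fun x : ℝ => (x : ℂ)) F upperInfty := tendsto_ofReal_upperInfty hF
  have t2 : Tendsto (fun x : ℝ => ((-x : ℝ) : ℂ)) F upperInfty :=
    (tendsto_ofReal_upperInfty le_rfl).comp (tendsto_neg_cobounded.mono_left hF)
  have hlim := (((h0'.comp t2).star).mul ((h1.comp t1).star)).sub
    (((h1'.comp t2).star).mul ((h0.comp t1).star))
  -- Both limit vectors are multiples of (1 + m₃(0), m₁(0) + i m₂(0)), so their determinant vanishes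
  -- whatever `c` and `c'` are.
  have hzero : star (c' * (1 + (m (-0) 2 : ℂ))) *
      star (c * ((m 0 0 : ℂ) + Complex.I * (m 0 1 : ℂ))) -
      star (c' * ((m (-0) 0 : ℂ) + Complex.I * (m (-0) 1 : ℂ))) *
      star (c * (1 + (m 0 2 : ℂ))) = 0 := by
    rw [neg_zero, ← star_mul', ← star_mul', ← star_sub, star_eq_zero]
    ring
  rw [hzero] at hlim
  refine hlim.congr fun x => ?_
  have e1 : ∀ i, n 0 x i = psi m 0 x i := fun i => by
    rw [← hn 0 x (ofReal_mem_closure_upperPlane x) i]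
    simp
  have e2 : ∀ i, n' 0 ((-x : ℝ) : ℂ) i = phiBar m 0 x i := fun i => by
    rw [← hn' 0 _ (ofReal_mem_closure_upperPlane (-x)) i,
      phiBar_eq_psi hm (ofReal_mem_closure_lowerPlane x)]
    simp
  simp only [Function.comp_apply, e1, e2, b_eq hm x]

end Scattering

/-! ### The coefficient `b` at small spectral parameter -/

section SmallParameter

variable (hm : Admissible m)
include hm

/-- The function tends to 0 at +∞ and to the conjugate of b at -∞, so integrating the derivative
represents b by an integral over the line. -/
theorem hasDerivAt_exp_mul_psi_one (x z : ℝ) :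
    HasDerivAt (fun z : ℝ => Complex.exp (Complex.I * x * z) * psi m z x 1)
      (Complex.I * x * (Complex.exp (2 * Complex.I * x * z) *
        (((m z 0 : ℂ) + Complex.I * (m z 1 : ℂ)) *
          (Complex.exp (-(Complex.I * x * z)) * psi m z x 0) -
        ((m z 2 : ℂ) - 1) * (Complex.exp (-(Complex.I * x * z)) * psi m z x 1)))) z := by
  have h1 := hasDerivAt_exp_mul_ofReal (Complex.I * x) z
  refine (h1.fun_mul (isSolution_iff.1
    (isSolution_psi hm (ofReal_mem_closure_upperPlane x)) z).2).congr_deriv ?_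
  have he : Complex.exp (2 * Complex.I * x * z) * Complex.exp (-(Complex.I * x * z)) =
      Complex.exp (Complex.I * x * z) := by
    rw [← Complex.exp_add]
    congr 1
    ring
  linear_combination -Complex.I * x * (((m z 0 : ℂ) + Complex.I * (m z 1 : ℂ)) * psi m z x 0 -
    ((m z 2 : ℂ) - 1) * psi m z x 1) * he

omit hm in
theorem norm_exp_two_I_mul_ofReal (x z : ℝ) : ‖Complex.exp (2 * Complex.I * x * z)‖ = 1 := by
  rw [Complex.norm_exp]
  simp

theorem tendsto_exp_mul_psi_one_atTop (x : ℝ) :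
    Tendsto (fun z : ℝ => Complex.exp (Complex.I * x * z) * psi m z x 1) atTop (𝓝 0) := by
  have h : Tendsto (fun z : ℝ => ‖Complex.exp (-(1 * Complex.I * x * z)) * psi m z x 1‖) atTop
      (𝓝 0) := by
    simpa using (tendsto_apply_of_isJost (isPsi_psi hm (ofReal_mem_closure_upperPlane x)) 1).norm
  refine squeeze_zero_norm (fun z => le_of_eq ?_) h
  rw [norm_mul, norm_mul, Complex.norm_exp, Complex.norm_exp]
  simp

theorem tendsto_exp_mul_psi_one_atBot (x : ℝ) :
    Tendsto (fun z : ℝ => Complex.exp (Complex.I * x * z) * psi m z x 1) atBot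
      (𝓝 (star (b m x))) := by
  have h1 : Tendsto (fun z : ℝ => Complex.exp (Complex.I * x * z) * phi m z x 1) atBot (𝓝 1) := by
    simpa using tendsto_apply_of_isJost (isPhi_phi hm (ofReal_mem_closure_upperPlane x)) 1
  have h2 : Tendsto (fun z : ℝ => Complex.exp (Complex.I * x * z) * phiBar m z x 1) atBot
      (𝓝 0) := by
    have h : Tendsto (fun z : ℝ => ‖Complex.exp (-(1 * Complex.I * x * z)) * phiBar m z x 1‖) atBot
        (𝓝 0) := by
      simpa using
        (tendsto_apply_of_isJost (isPhiBar_phiBar hm (ofReal_mem_closure_lowerPlane x)) 1).norm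
    refine squeeze_zero_norm (fun z => le_of_eq ?_) h
    rw [norm_mul, norm_mul, Complex.norm_exp, Complex.norm_exp]
    simp
  have := (h2.const_mul (a m x)).add (h1.const_mul (star (b m x)))
  rw [mul_zero, zero_add, mul_one] at this
  refine this.congr fun z => ?_
  rw [psi_eq_add hm x z]
  simp only [Pi.add_apply, Pi.smul_apply, smul_eq_mul]
  ring

/-- First order expansion of `b` at `0`, with a quadratic error bound. -/
theorem exists_norm_star_b_add_le : ∃ K, ∀ x : ℝ, ‖star (b m x) + Complex.I * x *
    ∫ z : ℝ, Complex.exp (2 * Complex.I * x * z) * ((m z 0 : ℂ) + Complex.I * (m z 1 : ℂ))‖ ≤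
      K * x ^ 2 := by
  obtain ⟨C, hC⟩ := exists_bound_faddeev hm
  have hC0 : 0 ≤ C := (norm_nonneg _).trans (hC 0 0 (ofReal_mem_closure_upperPlane 0) 0)
  set k : ℝ → ℝ := fun z => ‖(m z 2 : ℂ) - 1‖ + (‖(m z 0 : ℂ)‖ + ‖(m z 1 : ℂ)‖) with hk
  have hki : Integrable k := (integrable_sub_one hm).norm.add
    ((integrable_coord_zero hm).norm.add (integrable_coord_one hm).norm)
  set J := ∫ z, k z with hJ
  have hk0 : ∀ z, 0 ≤ k z := fun z => by positivity
  have hJ0 : 0 ≤ J := integral_nonneg hk0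
  have hpm : ∀ s : ℂ, ‖s‖ ≤ 1 → ∀ z, ‖(m z 0 : ℂ) + s * (m z 1 : ℂ)‖ ≤
      ‖(m z 0 : ℂ)‖ + ‖(m z 1 : ℂ)‖ := by
    intro s hs z
    refine (norm_add_le _ _).trans ?_
    rw [norm_mul]
    exact add_le_add_right (mul_le_of_le_one_left (norm_nonneg _) hs) _
  have hcomb : ∀ z (y₁ y₂ s : ℂ) (c : ℝ), ‖s‖ ≤ 1 → ‖y₁‖ ≤ c → ‖y₂‖ ≤ c →
      ‖((m z 2 : ℂ) - 1) * y₁‖ + ‖((m z 0 : ℂ) + s * (m z 1 : ℂ)) * y₂‖ ≤ k z * c := by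
    intro z y₁ y₂ s c hs h1 h2
    rw [norm_mul, norm_mul, hk, add_mul]
    have hc : 0 ≤ c := (norm_nonneg _).trans h1
    exact add_le_add (mul_le_mul_of_nonneg_left h1 (norm_nonneg _))
      (mul_le_mul (hpm s hs z) h2 (norm_nonneg _) (by positivity))
  have hmp : Integrable fun z => (m z 0 : ℂ) + Complex.I * (m z 1 : ℂ) :=
    (integrable_coord_zero hm).add ((integrable_coord_one hm).const_mul Complex.I)
  have hmm : Integrable fun z => (m z 0 : ℂ) - Complex.I * (m z 1 : ℂ) :=
    (integrable_coord_zero hm).sub ((integrable_coord_one hm).const_mul Complex.I)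
  have hexp : ∀ (x : ℝ) {g : ℝ → ℂ}, Integrable g →
      Integrable fun z : ℝ => Complex.exp (2 * Complex.I * x * z) * g z := fun x g hg =>
    hg.bdd_mul (c := 1) (by fun_prop : Continuous fun z : ℝ =>
      Complex.exp (2 * Complex.I * x * z)).aestronglyMeasurable
      (Eventually.of_forall fun z => (norm_exp_two_I_mul_ofReal x z).le)
  set N : ℝ → ℝ → Fin 2 → ℂ := fun x z i =>
    Complex.exp (-(Complex.I * x * z)) * psi m z x i with hN
  have hNC : ∀ x z i, ‖N x z i‖ ≤ C := fun x z i => hC z x (ofReal_mem_closure_upperPlane x) i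
  have hNi : ∀ x i {w : ℝ → ℂ}, Integrable w → Integrable fun z => w z * N x z i :=
    fun x i w hw => integrable_mul_faddeev hm (ofReal_mem_closure_upperPlane x) i hw
  have htail : ∀ {g : ℝ → ℂ} (x z : ℝ), (∀ z, ‖g z‖ ≤ |x| * (k z * C)) →
      ‖∫ y in Ioi z, g y‖ ≤ C * J * |x| := by
    intro g x z hg
    have hi : Integrable fun z => |x| * (k z * C) := (hki.mul_const C).const_mul _
    calc ‖∫ y in Ioi z, g y‖ ≤ ∫ y in Ioi z, |x| * (k y * C) :=
          norm_integral_le_of_norm_le hi.integrableOn (Eventually.of_forall hg)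
      _ ≤ ∫ y, |x| * (k y * C) := setIntegral_le_integral hi
          (Eventually.of_forall fun y => mul_nonneg (abs_nonneg _) (mul_nonneg (hk0 y) hC0))
      _ = C * J * |x| := by
          rw [integral_const_mul, integral_mul_const]
          ring
  have hIx : ∀ x : ℝ, ‖Complex.I * (x : ℂ)‖ = |x| := fun x => by simp
  -- Integrating back from +∞, where the value is 1; the derivative carries a factor x. The lower
  -- component is treated alike in `hN1`.
  have hN0 : ∀ x z, ‖N x z 0 - 1‖ ≤ C * J * |x| := by
    intro x z
    have htop : Tendsto (fun z : ℝ => N x z 0) atTop (𝓝 1) := by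
      simpa using tendsto_apply_of_isJost (isPsi_psi hm (ofReal_mem_closure_upperPlane x)) 0
    have := integral_Ioi_of_hasDerivAt_of_tendsto' (a := z)
      (fun y _ => hasDerivAt_faddeev_zero hm (ofReal_mem_closure_upperPlane x) y)
      (((hNi x 0 (integrable_sub_one hm)).add (hNi x 1 hmm)).const_mul
        (Complex.I * x)).integrableOn htop
    rw [norm_sub_rev, ← this]
    refine htail x z fun y => ?_
    rw [norm_mul, hIx]
    refine mul_le_mul_of_nonneg_left ((norm_add_le _ _).trans ?_) (abs_nonneg x)
    have := hcomb y (N x y 0) (N x y 1) (-Complex.I) C (by simp) (hNC x y 0) (hNC x y 1)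
    simpa [hN, sub_eq_add_neg] using this
  have hInt : ∀ x : ℝ, Integrable fun z : ℝ => Complex.I * x *
      (Complex.exp (2 * Complex.I * x * z) * (((m z 0 : ℂ) + Complex.I * (m z 1 : ℂ)) * N x z 0 -
        ((m z 2 : ℂ) - 1) * N x z 1)) := fun x =>
    (hexp x ((hNi x 0 hmp).sub (hNi x 1 (integrable_sub_one hm)))).const_mul _
  have hN1 : ∀ x z, ‖N x z 1‖ ≤ C * J * |x| := by
    intro x z
    have := integral_Ioi_of_hasDerivAt_of_tendsto' (a := z)
      (fun y _ => hasDerivAt_exp_mul_psi_one hm x y) (hInt x).integrableOn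
      (tendsto_exp_mul_psi_one_atTop hm x)
    have hnorm : ‖N x z 1‖ = ‖0 - Complex.exp (Complex.I * x * z) * psi m z x 1‖ := by
      rw [zero_sub, norm_neg, norm_mul, norm_mul, Complex.norm_exp, Complex.norm_exp]
      simp
    rw [hnorm, ← this]
    refine htail x z fun y => ?_
    rw [norm_mul, hIx, norm_mul, norm_exp_two_I_mul_ofReal, one_mul]
    refine mul_le_mul_of_nonneg_left ((norm_sub_le _ _).trans ?_) (abs_nonneg x)
    rw [add_comm]
    exact hcomb y (N x y 1) (N x y 0) Complex.I C (by simp) (hNC x y 1) (hNC x y 0)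
  -- Replacing the Faddeev vector by (1, 0) costs `C * J * |x|` pointwise; integrating against `k`
  -- gives another `J`, and the prefactor ix another |x|.
  refine ⟨C * J * J, fun x => ?_⟩
  have hb := integral_of_hasDerivAt_of_tendsto (hasDerivAt_exp_mul_psi_one hm x) (hInt x)
    (tendsto_exp_mul_psi_one_atBot hm x) (tendsto_exp_mul_psi_one_atTop hm x)
  rw [integral_const_mul, zero_sub] at hb
  have hdiff : star (b m x) + Complex.I * x *
      ∫ z : ℝ, Complex.exp (2 * Complex.I * x * z) * ((m z 0 : ℂ) + Complex.I * (m z 1 : ℂ)) =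
      Complex.I * x * ∫ z : ℝ, Complex.exp (2 * Complex.I * x * z) *
        (((m z 2 : ℂ) - 1) * N x z 1 -
          ((m z 0 : ℂ) + Complex.I * (m z 1 : ℂ)) * (N x z 0 - 1)) := by
    have hsub := integral_sub (hexp x hmp)
      (hexp x ((hNi x 0 hmp).sub (hNi x 1 (integrable_sub_one hm))))
    rw [← neg_neg (star (b m x)), ← hb, neg_add_eq_sub, ← mul_sub]
    refine congrArg _ (hsub.symm.trans ?_)
    refine integral_congr_ae (Eventually.of_forall fun z => ?_)
    simp only [Pi.sub_apply]
    ring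
  rw [hdiff, norm_mul, hIx]
  have hx2 : C * J * J * x ^ 2 = |x| * (J * (C * J * |x|)) := by
    rw [← sq_abs]; ring
  rw [hx2, hJ, ← integral_mul_const, ← hJ]
  refine mul_le_mul_of_nonneg_left (norm_integral_le_of_norm_le (hki.mul_const _)
    (Eventually.of_forall fun z => ?_)) (abs_nonneg x)
  rw [norm_mul, norm_exp_two_I_mul_ofReal, one_mul]
  exact (norm_sub_le _ _).trans (hcomb z _ _ Complex.I _ (by simp) (hN1 x z) (hN0 x z))

/-- If `b` has an analytic continuation at `0`, then the Fourier transform of `m₁ + i m₂` is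
Lipschitz at `0`. -/
theorem exists_norm_fourier_sub_le {U : Set ℂ} {F : ℂ → ℂ} (hU : IsOpen U) (h0 : (0 : ℂ) ∈ U)
    (hF : AnalyticOnNhd ℂ F U) (hFb : ∀ x : ℝ, F x = b m x) : ∃ K, ∀ᶠ x : ℝ in 𝓝[>] 0,
    ‖(∫ z : ℝ, ((m z 0 : ℂ) + Complex.I * (m z 1 : ℂ))) -
      ∫ z : ℝ, Complex.exp (2 * Complex.I * x * z) * ((m z 0 : ℂ) + Complex.I * (m z 1 : ℂ))‖ ≤
      K * x := by
  obtain ⟨K, hK⟩ := exists_norm_star_b_add_le hm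
  set w : ℝ → ℂ := fun z => (m z 0 : ℂ) + Complex.I * (m z 1 : ℂ)
  have hwi : Integrable w :=
    (integrable_coord_zero hm).add ((integrable_coord_one hm).const_mul Complex.I)
  set G : ℝ → ℂ := fun x => ∫ z : ℝ, Complex.exp (2 * Complex.I * x * z) * w z with hG
  have hGc : Continuous G := by
    refine continuous_of_dominated (bound := fun z => ‖w z‖) (fun x => ?_) (fun x => ?_) hwi.norm ?_
    · exact ((by fun_prop : Continuous fun z : ℝ =>
        Complex.exp (2 * Complex.I * x * z)).aestronglyMeasurable).mul hwi.aestronglyMeasurable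
    · exact Eventually.of_forall fun z => by
        rw [norm_mul, norm_exp_two_I_mul_ofReal, one_mul]
    · exact Eventually.of_forall fun z => by fun_prop
  have hG0 : G 0 = ∫ z : ℝ, w z := by simp [hG]
  have hb0 : b m 0 = 0 := by
    have := hK 0
    simpa using this
  have hF0 : F 0 = 0 := by simpa [hb0] using hFb 0
  -- Since b(0) = 0, dividing by x leaves a function that is still analytic at 0, and its conjugate
  -- equals -i times the Fourier integral up to an error `K * x`.
  set D := dslope F 0 with hD
  have hDd : DifferentiableAt ℂ D 0 :=
    ((Complex.differentiableOn_dslope (hU.mem_nhds h0)).2 hF.differentiableOn).differentiableAt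
      (hU.mem_nhds h0)
  have hDx : ∀ x : ℝ, 0 < x → ‖star (D x) + Complex.I * G x‖ ≤ K * x := by
    intro x hx
    have hx0 : (x : ℂ) ≠ 0 := by exact_mod_cast hx.ne'
    have h1 : b m x = x * D x := by
      rw [hD, dslope_of_ne _ hx0, slope_def_field, hF0, hFb]
      field_simp
      ring
    have h2 := hK x
    rw [h1, star_mul', Complex.star_def, Complex.conj_ofReal] at h2
    have h3 : (x : ℂ) * (starRingEnd ℂ) (D x) + Complex.I * x * G x =
        x * (star (D x) + Complex.I * G x) := by
      rw [Complex.star_def]; ring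
    rw [h3, norm_mul, Complex.norm_real, Real.norm_of_nonneg hx.le] at h2
    exact le_of_mul_le_mul_left (by linarith) hx
  have hcast : Tendsto (fun x : ℝ => (x : ℂ)) (𝓝[>] 0) (𝓝 0) :=
    (Complex.continuous_ofReal.tendsto' 0 0 (by simp)).mono_left nhdsWithin_le_nhds
  have hD0 : star (D 0) + Complex.I * G 0 = 0 := by
    have h1 : Tendsto (fun x : ℝ => star (D x) + Complex.I * G x) (𝓝[>] 0)
        (𝓝 (star (D 0) + Complex.I * G 0)) :=
      ((hDd.continuousAt.tendsto.comp hcast).star).add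
        (((hGc.tendsto 0).mono_left nhdsWithin_le_nhds).const_mul _)
    have h2 : Tendsto (fun x : ℝ => star (D x) + Complex.I * G x) (𝓝[>] 0) (𝓝 0) := by
      have h3 : Tendsto (fun x : ℝ => K * x) (𝓝[>] 0) (𝓝 0) :=
        ((continuous_const.mul continuous_id).tendsto' 0 0 (by simp)).mono_left nhdsWithin_le_nhds
      exact squeeze_zero_norm' (eventually_nhdsWithin_of_forall fun x hx => hDx x hx) h3
    exact tendsto_nhds_unique h1 h2
  obtain ⟨K', hK'⟩ := (hDd.isBigO_sub.comp_tendsto hcast).bound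
  refine ⟨K + K', ?_⟩
  filter_upwards [hK', self_mem_nhdsWithin] with x hx hx0
  have hx0' : 0 < x := hx0
  rw [← hG0]
  change ‖G 0 - G x‖ ≤ _
  simp only [Function.comp_apply, sub_zero, Complex.norm_real, Real.norm_of_nonneg hx0'.le] at hx
  have h1 : ‖G 0 - G x‖ = ‖(star (D x) + Complex.I * G x) - star (D x - D 0)‖ * 1 := by
    rw [mul_one, star_sub]
    have : star (D x) + Complex.I * G x - (star (D x) - star (D 0)) =
        -Complex.I * (G 0 - G x) := by linear_combination hD0
    rw [this, norm_mul]
    simp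
  rw [h1, mul_one]
  refine (norm_sub_le _ _).trans ?_
  rw [norm_star, add_mul]
  exact add_le_add (hDx x hx0') hx

end SmallParameter

/-! ### A potential with slowly decaying tails -/

/-- The decay of order |z|^{-3/2} is integrable, but too slow for a Fourier transform that is
Lipschitz at 0. -/
noncomputable def tailProfile (z : ℝ) : ℝ := (1 + z ^ 2) ^ (-(3 / 4) : ℝ)

/-- The spin field with stereographic coordinate `tailProfile`. -/
noncomputable def tailPotential (z : ℝ) : EuclideanSpace ℝ (Fin 3) :=
  !₂[2 * tailProfile z / (1 + tailProfile z ^ 2), 0,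
    (1 - tailProfile z ^ 2) / (1 + tailProfile z ^ 2)]

theorem tailProfile_pos (z : ℝ) : 0 < tailProfile z := by
  unfold tailProfile
  positivity

theorem tailProfile_le_one (z : ℝ) : tailProfile z ≤ 1 :=
  Real.rpow_le_one_of_one_le_of_nonpos (by nlinarith [sq_nonneg z]) (by norm_num)

theorem integrable_tailProfile : Integrable tailProfile := by
  have := integrable_rpow_neg_one_add_norm_sq (E := ℝ) (μ := volume) (r := 3 / 2)
    (by norm_num)
  refine this.congr (Eventually.of_forall fun z => ?_)
  simp only [tailProfile, Real.norm_eq_abs, sq_abs]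
  norm_num

theorem hasDerivAt_tailProfile (z : ℝ) :
    HasDerivAt tailProfile (-(3 / 2) * (z / (1 + z ^ 2)) * tailProfile z) z := by
  have h1 : HasDerivAt (fun z : ℝ => 1 + z ^ 2) (2 * z) z := by
    simpa using (hasDerivAt_pow 2 z).const_add 1
  have hpos : (0 : ℝ) < 1 + z ^ 2 := by positivity
  refine (h1.rpow_const (p := -(3 / 4)) (Or.inl hpos.ne')).congr_deriv ?_
  rw [Real.rpow_sub_one hpos.ne', tailProfile]
  ring

theorem abs_deriv_tailProfile_le (z : ℝ) :
    |-(3 / 2) * (z / (1 + z ^ 2)) * tailProfile z| ≤ tailProfile z := by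
  rw [abs_mul, abs_of_pos (tailProfile_pos z)]
  refine mul_le_of_le_one_left (tailProfile_pos z).le ?_
  have hpos : (0 : ℝ) < 1 + z ^ 2 := by positivity
  rw [abs_mul, abs_div, abs_of_pos hpos, abs_neg, abs_of_pos (by norm_num : (0 : ℝ) < 3 / 2),
    ← mul_div_assoc, div_le_one hpos]
  nlinarith [sq_nonneg (|z| - 1), sq_abs z]

theorem contDiff_tailProfile : ContDiff ℝ 1 tailProfile :=
  ContDiff.rpow_const_of_ne (by fun_prop) fun z => by positivity

theorem hasDerivAt_tailPotential_zero (z : ℝ) : HasDerivAt (fun z => tailPotential z 0)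
    (2 * (1 - tailProfile z ^ 2) / (1 + tailProfile z ^ 2) ^ 2 *
      (-(3 / 2) * (z / (1 + z ^ 2)) * tailProfile z)) z := by
  have hu := hasDerivAt_tailProfile z
  have hpos : 1 + tailProfile z ^ 2 ≠ 0 := by positivity
  refine ((hu.const_mul 2).fun_div ((hu.fun_pow 2).const_add 1) hpos).congr_deriv ?_
  field_simp
  ring

theorem hasDerivAt_tailPotential_two (z : ℝ) : HasDerivAt (fun z => tailPotential z 2)
    (-(4 * tailProfile z) / (1 + tailProfile z ^ 2) ^ 2 *
      (-(3 / 2) * (z / (1 + z ^ 2)) * tailProfile z)) z := by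
  have hu := hasDerivAt_tailProfile z
  have hpos : 1 + tailProfile z ^ 2 ≠ 0 := by positivity
  refine (((hu.fun_pow 2).const_sub 1).fun_div ((hu.fun_pow 2).const_add 1) hpos).congr_deriv ?_
  field_simp
  ring

theorem contDiff_tailPotential (i : Fin 3) : ContDiff ℝ 1 fun z => tailPotential z i := by
  have hu := contDiff_tailProfile
  have hpos : ∀ z, 1 + tailProfile z ^ 2 ≠ 0 := fun z => by positivity
  fin_cases i
  · exact (contDiff_const.mul hu).div (contDiff_const.add (hu.pow 2)) hpos
  · exact contDiff_const
  · exact (contDiff_const.sub (hu.pow 2)).div (contDiff_const.add (hu.pow 2)) hpos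

theorem integrable_of_abs_le_tailProfile {f : ℝ → ℝ} {C : ℝ} (hf : Measurable f)
    (h : ∀ z, |f z| ≤ C * tailProfile z) : Integrable f :=
  (integrable_tailProfile.const_mul C).mono' hf.aestronglyMeasurable (Eventually.of_forall h)

theorem admissible_tailPotential : Admissible tailPotential where
  norm_eq_one z := by
    have hpos : 1 + tailProfile z ^ 2 ≠ 0 := by positivity
    have h : ‖tailPotential z‖ ^ 2 = 1 := by
      rw [EuclideanSpace.real_norm_sq_eq, Fin.sum_univ_three]
      simp only [tailPotential, Fin.isValue, PiLp.toLp_apply, Matrix.cons_val_zero,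
        Matrix.cons_val_one, Matrix.cons_val]
      field_simp
      ring
    exact (pow_eq_one_iff_of_nonneg (norm_nonneg _) two_ne_zero).1 h
  integrable_sub i := by
    refine integrable_of_abs_le_tailProfile (C := 2)
      ((contDiff_tailPotential i).continuous.measurable.sub_const _) fun z => ?_
    have hu := tailProfile_pos z
    have hu1 := tailProfile_le_one z
    have hpos : 0 < 1 + tailProfile z ^ 2 := by positivity
    fin_cases i
    · simp [tailPotential, e₃]
      rw [abs_of_nonneg (by positivity), div_le_iff₀ hpos]
      nlinarith [mul_pos hu hu, mul_pos hu (mul_pos hu hu)]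
    · simp [tailPotential, e₃]
      exact hu.le
    · have : (1 - tailProfile z ^ 2) / (1 + tailProfile z ^ 2) - 1 =
          -(2 * tailProfile z ^ 2 / (1 + tailProfile z ^ 2)) := by
        field_simp
        ring
      simp [tailPotential, e₃]
      rw [this, abs_neg, abs_of_nonneg (by positivity), div_le_iff₀ hpos]
      nlinarith [mul_pos hu hu, mul_pos hu (mul_pos hu hu)]
  absolutelyContinuous i x y :=
    (contDiff_tailPotential i).contDiffOn.absolutelyContinuousOnInterval
  ae_differentiable := Eventually.of_forall fun z => by
    rw [differentiableAt_euclidean]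
    exact fun i => (contDiff_tailPotential i).differentiable one_ne_zero z
  integrable_deriv i := by
    refine integrable_of_abs_le_tailProfile (C := 4) (measurable_deriv _) fun z => ?_
    have hu := tailProfile_pos z
    have hu1 := tailProfile_le_one z
    have hpos : 0 < 1 + tailProfile z ^ 2 := by positivity
    have hone : 1 ≤ (1 + tailProfile z ^ 2) ^ 2 := by nlinarith [mul_pos hu hu]
    have key : ∀ c : ℝ, |c| ≤ 4 → |c / (1 + tailProfile z ^ 2) ^ 2 *
        (-(3 / 2) * (z / (1 + z ^ 2)) * tailProfile z)| ≤ 4 * tailProfile z := by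
      intro c hc
      rw [abs_mul, abs_div, abs_of_pos (by positivity : 0 < (1 + tailProfile z ^ 2) ^ 2)]
      refine mul_le_mul ?_ (abs_deriv_tailProfile_le z) (abs_nonneg _) (by norm_num)
      exact (div_le_self (abs_nonneg c) hone).trans hc
    fin_cases i
    · simp only [Fin.zero_eta]
      rw [(hasDerivAt_tailPotential_zero z).deriv]
      refine key _ (abs_le.2 ⟨?_, ?_⟩) <;> nlinarith
    · have : (fun z => tailPotential z 1) = fun _ => 0 := rfl
      simp only [Fin.mk_one, this, deriv_const, abs_zero]
      positivity
    · simp only [Fin.reduceFinMk]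
      rw [(hasDerivAt_tailPotential_two z).deriv]
      refine key _ (abs_le.2 ⟨?_, ?_⟩) <;> nlinarith
  neg_one_lt z := by
    have hpos : 0 < 1 + tailProfile z ^ 2 := by positivity
    have : tailPotential z 2 = (1 - tailProfile z ^ 2) / (1 + tailProfile z ^ 2) := rfl
    rw [this, lt_div_iff₀ hpos]
    linarith

theorem tailProfile_le_tailPotential (z : ℝ) : tailProfile z ≤ tailPotential z 0 := by
  have hu := tailProfile_pos z
  have hu1 := tailProfile_le_one z
  have : tailPotential z 0 = 2 * tailProfile z / (1 + tailProfile z ^ 2) := rfl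
  rw [this, le_div_iff₀ (by positivity)]
  nlinarith [mul_pos hu hu]

/-- The real part of the difference is the integral of (1 - cos 2xz) m₁ with m₁ ≥ 0. At x = π/(2R)
the tail near |z| = R alone contributes order R^{-1/2}, whereas a Lipschitz bound allows only order
R^{-1}. -/
theorem fourier_tailPotential_not_lipschitz (K : ℝ) : ¬ ∀ᶠ x : ℝ in 𝓝[>] 0,
    ‖(∫ z : ℝ, ((tailPotential z 0 : ℂ) + Complex.I * (tailPotential z 1 : ℂ))) -
      ∫ z : ℝ, Complex.exp (2 * Complex.I * x * z) *
        ((tailPotential z 0 : ℂ) + Complex.I * (tailPotential z 1 : ℂ))‖ ≤ K * x := by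
  intro hev
  have h1 : ∀ z, (tailPotential z 1 : ℂ) = 0 := fun z => by simp [tailPotential]
  simp only [h1, mul_zero, add_zero] at hev
  set s : ℝ → ℝ := fun z => tailPotential z 0 with hs
  have hsi : Integrable s := by
    simpa [e₃] using admissible_tailPotential.integrable_sub 0
  have hs0 : ∀ z, 0 ≤ s z := fun z =>
    (tailProfile_pos z).le.trans (tailProfile_le_tailPotential z)
  have hcosi : ∀ x : ℝ, Integrable fun z => (1 - Real.cos (2 * x * z)) * s z := fun x =>
    hsi.bdd_mul (c := 2) (by fun_prop : Continuous fun z : ℝ =>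
      1 - Real.cos (2 * x * z)).aestronglyMeasurable (Eventually.of_forall fun z => by
        rw [Real.norm_eq_abs, abs_le]
        constructor <;> linarith [Real.neg_one_le_cos (2 * x * z), Real.cos_le_one (2 * x * z)])
  have hre : ∀ x : ℝ, ((∫ z : ℝ, (s z : ℂ)) -
      ∫ z : ℝ, Complex.exp (2 * Complex.I * x * z) * (s z : ℂ)).re =
      ∫ z : ℝ, (1 - Real.cos (2 * x * z)) * s z := by
    intro x
    have hsc : Integrable fun z => (s z : ℂ) := hsi.ofReal
    have hei : Integrable fun z : ℝ => Complex.exp (2 * Complex.I * x * z) * (s z : ℂ) :=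
      hsc.bdd_mul (c := 1) (by fun_prop : Continuous fun z : ℝ =>
        Complex.exp (2 * Complex.I * x * z)).aestronglyMeasurable
        (Eventually.of_forall fun z => (norm_exp_two_I_mul_ofReal x z).le)
    rw [← integral_sub hsc hei]
    refine (Complex.reCLM.integral_comp_comm (hsc.sub hei)).symm.trans ?_
    refine integral_congr_ae (Eventually.of_forall fun z => ?_)
    have : 2 * Complex.I * x * z = ((2 * x * z : ℝ) : ℂ) * Complex.I := by push_cast; ring
    simp only [Pi.sub_apply, Complex.reCLM_apply, Complex.sub_re, Complex.ofReal_re, this,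
      Complex.re_mul_ofReal,
      Complex.exp_ofReal_mul_I_re]
    ring
  -- On [R/2, R] the phase πz/R lies in [π/2, π], so 1 - cos ≥ 1, and m₁ dominates the decreasing
  -- profile.
  have hlow : ∀ R : ℝ, 0 < R → R / 2 * tailProfile R ≤
      ∫ z : ℝ, (1 - Real.cos (2 * (Real.pi / (2 * R)) * z)) * s z := by
    intro R hR
    have hnn : ∀ z, 0 ≤ (1 - Real.cos (2 * (Real.pi / (2 * R)) * z)) * s z := fun z =>
      mul_nonneg (by linarith [Real.cos_le_one (2 * (Real.pi / (2 * R)) * z)]) (hs0 z)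
    calc R / 2 * tailProfile R = ∫ z in Icc (R / 2) R, tailProfile R := by
          rw [setIntegral_const, Measure.real, Real.volume_Icc,
            ENNReal.toReal_ofReal (by linarith), smul_eq_mul]
          ring
      _ ≤ ∫ z in Icc (R / 2) R, (1 - Real.cos (2 * (Real.pi / (2 * R)) * z)) * s z := by
          refine setIntegral_mono_on (by simp) (hcosi _).integrableOn measurableSet_Icc
            fun z hz => ?_
          have hcos : Real.cos (2 * (Real.pi / (2 * R)) * z) ≤ 0 := by
            have hπ := Real.pi_pos
            have he : 2 * (Real.pi / (2 * R)) * z = Real.pi * (z / R) := by field_simp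
            have hlo : 1 / 2 ≤ z / R := by rw [le_div_iff₀ hR]; linarith [hz.1]
            have hhi : z / R ≤ 1 := by rw [div_le_one hR]; exact hz.2
            rw [he]
            exact Real.cos_nonpos_of_pi_div_two_le_of_le (by nlinarith) (by nlinarith)
          have hmono : tailProfile R ≤ tailProfile z := by
            unfold tailProfile
            refine Real.rpow_le_rpow_of_nonpos (by positivity) ?_ (by norm_num)
            nlinarith [hz.1, hz.2]
          calc tailProfile R ≤ s z := hmono.trans (tailProfile_le_tailPotential z)
            _ ≤ _ := le_mul_of_one_le_left (hs0 z) (by linarith)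
      _ ≤ _ := setIntegral_le_integral (hcosi _) (Eventually.of_forall hnn)
  have htend : Tendsto (fun R : ℝ => Real.pi / (2 * R)) atTop (𝓝[>] 0) := by
    refine tendsto_nhdsWithin_iff.2 ⟨?_, ?_⟩
    · exact Tendsto.const_div_atTop (tendsto_id.const_mul_atTop two_pos) _
    · filter_upwards [eventually_gt_atTop 0] with R hR
      exact div_pos Real.pi_pos (by positivity)
  -- The threshold `8 * (K * π) ^ 4` contradicts the bound `h7` on R², since R ≥ 1 gives R² ≥ R.
  obtain ⟨R, hRev, hR1, hRK⟩ := ((htend.eventually hev).and ((eventually_ge_atTop 1).and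
    (eventually_gt_atTop (8 * (K * Real.pi) ^ 4)))).exists
  have hR0 : 0 < R := by linarith
  have hle : R / 2 * tailProfile R ≤ K * (Real.pi / (2 * R)) :=
    (hlow R hR0).trans ((hre _).symm.le.trans ((Complex.re_le_norm _).trans hRev))
  have hle' : R ^ 2 * tailProfile R ≤ K * Real.pi := by
    have := mul_le_mul_of_nonneg_left hle (by positivity : 0 ≤ 2 * R)
    have e : 2 * R * (K * (Real.pi / (2 * R))) = K * Real.pi := by field_simp
    rw [e] at this
    linarith
  -- Fourth powers clear the exponent -3/4 and leave a polynomial inequality.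
  have hpow : tailProfile R ^ 4 = ((1 + R ^ 2) ^ 3)⁻¹ := by
    rw [tailProfile, ← Real.rpow_natCast, ← Real.rpow_mul (by positivity),
      ← Real.rpow_natCast (1 + R ^ 2) 3, ← Real.rpow_neg (by positivity)]
    norm_num
  have h4 := pow_le_pow_left₀ (by have := tailProfile_pos R; positivity) hle' 4
  rw [mul_pow, hpow, ← div_eq_mul_inv, div_le_iff₀ (by positivity)] at h4
  have h5 : (1 + R ^ 2) ^ 3 ≤ (2 * R ^ 2) ^ 3 := by
    gcongr
    nlinarith
  have hKnn : 0 ≤ (K * Real.pi) ^ 4 := by positivity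
  have h6 : R ^ 8 ≤ (8 * (K * Real.pi) ^ 4) * R ^ 6 := by
    calc R ^ 8 = (R ^ 2) ^ 4 := by ring
      _ ≤ (K * Real.pi) ^ 4 * (1 + R ^ 2) ^ 3 := h4
      _ ≤ (K * Real.pi) ^ 4 * (2 * R ^ 2) ^ 3 := mul_le_mul_of_nonneg_left h5 hKnn
      _ = _ := by ring
  have h7 : R ^ 2 ≤ 8 * (K * Real.pi) ^ 4 := by
    refine le_of_mul_le_mul_right ?_ (by positivity : 0 < R ^ 6)
    calc R ^ 2 * R ^ 6 = R ^ 8 := by ring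
      _ ≤ _ := h6
  nlinarith

theorem b_tailPotential_not_analytic : ¬ ∃ (U : Set ℂ) (F : ℂ → ℂ), IsOpen U ∧
    (∀ x : ℝ, (x : ℂ) ∈ U) ∧ AnalyticOnNhd ℂ F U ∧ ∀ x : ℝ, F x = b tailPotential x := by
  rintro ⟨U, F, hU, hRU, hF, hFb⟩
  obtain ⟨K, hK⟩ := exists_norm_fourier_sub_le admissible_tailPotential hU
    (by simpa using hRU 0) hF hFb
  exact fourier_tailPotential_not_lipschitz K hK

end Heisenberg

theorem theorem1 :
    (∀ m : ℝ → EuclideanSpace ℝ (Fin 3), Heisenberg.Admissible m →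
      -- the Jost functions are well defined
      (∀ l ∈ closure Heisenberg.upperPlane,
        (∃! f, Heisenberg.IsPsi m l f) ∧ (∃! f, Heisenberg.IsPhi m l f)) ∧
      (∀ l ∈ closure Heisenberg.lowerPlane,
        (∃! f, Heisenberg.IsPsiBar m l f) ∧ (∃! f, Heisenberg.IsPhiBar m l f)) ∧
      -- the Faddeev functions, both components (up and down)
      (∀ (z : ℝ) (i : Fin 2),
        Heisenberg.RegularWithLimit Heisenberg.upperPlane
          (fun l => Complex.exp (-(Complex.I * l * z)) * Heisenberg.psi m z l i) ∧
        Heisenberg.RegularWithLimit Heisenberg.upperPlane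
          (fun l => Complex.exp (Complex.I * l * z) * Heisenberg.phi m z l i) ∧
        Heisenberg.RegularWithLimit Heisenberg.lowerPlane
          (fun l => Complex.exp (Complex.I * l * z) * Heisenberg.psiBar m z l i) ∧
        Heisenberg.RegularWithLimit Heisenberg.lowerPlane
          (fun l => Complex.exp (-(Complex.I * l * z)) * Heisenberg.phiBar m z l i)) ∧
      -- the coefficients `a` and `b` are the entries of the transition matrix on the real line
      (∀ x z : ℝ, Heisenberg.Psi m z x = Heisenberg.Phi m z x *
        !![Heisenberg.a m x, -Heisenberg.b m x;
          star (Heisenberg.b m x), star (Heisenberg.a m x)]) ∧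
      Heisenberg.RegularWithLimit Heisenberg.upperPlane (Heisenberg.a m) ∧
      Tendsto (Heisenberg.b m) atTop (𝓝 0) ∧ Tendsto (Heisenberg.b m) atBot (𝓝 0)) ∧
    -- `b` may fail to admit an analytic continuation off the real line
    (∃ m : ℝ → EuclideanSpace ℝ (Fin 3), Heisenberg.Admissible m ∧
      ¬ ∃ (U : Set ℂ) (F : ℂ → ℂ), IsOpen U ∧ (∀ x : ℝ, (x : ℂ) ∈ U) ∧ AnalyticOnNhd ℂ F U ∧
        ∀ x : ℝ, F x = Heisenberg.b m x) := by
  refine ⟨fun m hm => ⟨fun l hl => ⟨⟨_, Heisenberg.isPsi_psi hm hl, fun g hg =>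
      Heisenberg.IsPsi.unique hm hl hg (Heisenberg.isPsi_psi hm hl)⟩,
      ⟨_, Heisenberg.isPhi_phi hm hl, fun g hg =>
        Heisenberg.IsPhi.unique hm hl hg (Heisenberg.isPhi_phi hm hl)⟩⟩,
    fun l hl => ⟨⟨_, Heisenberg.isPsiBar_psiBar hm hl, fun g hg =>
      Heisenberg.IsPsiBar.unique hm hl hg (Heisenberg.isPsiBar_psiBar hm hl)⟩,
      ⟨_, Heisenberg.isPhiBar_phiBar hm hl, fun g hg =>
        Heisenberg.IsPhiBar.unique hm hl hg (Heisenberg.isPhiBar_phiBar hm hl)⟩⟩,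
    fun z i => ⟨Heisenberg.regularWithLimit_psi hm z i, Heisenberg.regularWithLimit_phi hm z i,
      Heisenberg.regularWithLimit_psiBar hm z i, Heisenberg.regularWithLimit_phiBar hm z i⟩,
    Heisenberg.Psi_eq hm, Heisenberg.regularWithLimit_a hm, Heisenberg.tendsto_b hm ?_,
    Heisenberg.tendsto_b hm ?_⟩, Heisenberg.tailPotential,
    Heisenberg.admissible_tailPotential, Heisenberg.b_tailPotential_not_analytic⟩
  · rw [IsOrderBornology.cobounded_eq]
    exact le_sup_right
  · rw [IsOrderBornology.cobounded_eq]
    exact le_sup_left
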